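/- Throughout, $\|\cdot\|$ is the Euclidean norm on $\mathbb R^d$ and $\mathcal L$ is the (outer) Lebesgue measure on $\mathbb R$. A set $F\subseteq\mathbb R$ has *every portion of positive measure* if $\mathcal L(U\cap F)>0$ for every open $U\subseteq\mathbb R$ with $U\cap F\neq\emptyset$. A set $\mathscr F\subseteq\mathbb R^d$ has *every portion of positive cone width* if for every open $U\subseteq\mathbb R^d$ with $U\cap\mathscr F\neq\emptyset$ there is a $C^1$ curve $\nu_U\colon[0,1]\to\mathbb R^d$ with nowhere zero derivative (one-sided at the endpoints) such that $\mathcal L(\nu_U^{-1}(U\cap\mathscr F))>0$. A *1-Lipschitz curve* $\gamma\colon[0,1]\to\mathbb R^d$ is a mapping with $\|\gamma(s)-\gamma(t)\|\le|s-t|$ for all $s,t\in[0,1]$ for which there is $c>0$ with $\|\gamma'(t)\|\ge c$ for almost every $t\in[0,1]$. For an almost everywhere defined $\phi\colon[0,1]\to\mathbb R^d$ and measurable $U\subseteq[0,1]$ put $\operatorname{osc}(\phi,U)=\operatorname{ess\,sup}\{\|\phi(s)-\phi(t)\|: s,t\in U\}$, the essential supremum being over $(s,t)\in U\times U$. A set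 is residual in a topological space if its complement there is meagre, and residuality in a subset refers to the subspace topology. **Theorem.** Let $d\ge1$, let $\mathscr F\subseteq[0,1]^d$ be a non-empty closed set having every portion of positive cone width, and let $\mathscr A\subseteq(0,1)^d$ be an analytic set such that $\mathscr A\cap\mathscr F$ is residual in $\mathscr F$. Then there exist a 1-Lipschitz curve $\gamma\colon[0,1]\to(0,1)^d$ and sets $E\subseteq F\subseteq[0,1]$ such that: (i) $F$ is non-empty, closed and has every portion of positive measure; (ii) $E$ is residual in $F$; (iii) $\gamma$ is differentiable at every $t\in E$, with $\|\gamma'(t)\|=1$ (one-sided derivative if $t\in\{0,1\}$); (iv) for every $t\in E$, $\displaystyle\lim_{\delta\to0^+}\operatorname{osc}\bigl(\gamma',[t-\delta,t+\delta]\cap[0,1]\bigr)=0$; (v) $\gamma(E)\subseteq\mathscr A$. -/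

import Mathlib

open Set Filter Topology MeasureTheory

noncomputable section

/-- The open cube `(0,1)^d` in Euclidean space. -/
def openUnitCube (d : ℕ) : Set (EuclideanSpace ℝ (Fin d)) :=
  {x | ∀ i, x i ∈ Ioo (0 : ℝ) 1}

/-- The closed cube `[0,1]^d` in Euclidean space. -/
def closedUnitCube (d : ℕ) : Set (EuclideanSpace ℝ (Fin d)) :=
  {x | ∀ i, x i ∈ Icc (0 : ℝ) 1}

/-- The trace of `S` on `F` is residual in `F`, where `F` carries the subspace topology. -/
def IsResidualIn {X : Type*} [TopologicalSpace X] (S F : Set X) : Prop :=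
  ((↑) ⁻¹' S : Set F) ∈ residual F

/-- Every portion (nonempty relatively open subset) of `F` has positive Lebesgue measure. -/
def EveryPortionPositiveMeasure (F : Set ℝ) : Prop :=
  ∀ U : Set ℝ, IsOpen U → (U ∩ F).Nonempty → 0 < volume (U ∩ F)

/-- `ν` restricted to `[0,1]` is `C¹` (one-sided derivatives at the endpoints) with nowhere zero
derivative. -/
structure IsRegularC1Curve {d : ℕ} (ν : ℝ → EuclideanSpace ℝ (Fin d)) : Prop where
  contDiffOn : ContDiffOn ℝ 1 ν (Icc 0 1)
  deriv_ne_zero : ∀ t ∈ Icc (0 : ℝ) 1, derivWithin ν (Icc 0 1) t ≠ 0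

/-- Every portion of `F` is met in a set of parameters of positive measure by some `C¹` curve
on `[0,1]` with nowhere zero derivative. -/
def EveryPortionPositiveConeWidth {d : ℕ} (F : Set (EuclideanSpace ℝ (Fin d))) : Prop :=
  ∀ U : Set (EuclideanSpace ℝ (Fin d)), IsOpen U → (U ∩ F).Nonempty →
    ∃ ν : ℝ → EuclideanSpace ℝ (Fin d), IsRegularC1Curve ν ∧
      0 < volume (Icc (0 : ℝ) 1 ∩ ν ⁻¹' (U ∩ F))

/-- `γ` restricted to `[0,1]` is a Lipschitz curve with Lipschitz constant at most one: it is
`1`-Lipschitz there and its (almost everywhere defined) derivative is bounded away in magnitude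
from zero almost everywhere on `[0,1]`. -/
structure IsOneLipschitzCurve {d : ℕ} (γ : ℝ → EuclideanSpace ℝ (Fin d)) : Prop where
  lipschitzOn : LipschitzOnWith 1 γ (Icc 0 1)
  deriv_bounded_away : ∃ c : ℝ, 0 < c ∧
    ∀ᵐ t ∂(volume.restrict (Icc (0 : ℝ) 1)), c ≤ ‖derivWithin γ (Icc 0 1) t‖

/-- Essential oscillation of `φ` on `U`: the essential supremum of `‖φ s - φ t‖` over `s, t ∈ U`,
with values in `[0,∞]`. It does not see the values of `φ` on a null set. -/
def essOsc {d : ℕ} (φ : ℝ → EuclideanSpace ℝ (Fin d)) (U : Set ℝ) : ENNReal :=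
  essSup (fun p : ℝ × ℝ => ‖φ p.1 - φ p.2‖ₑ)
    ((volume.restrict U).prod (volume.restrict U))

end

/-! On short scales a regular C¹ curve is almost uniform motion along its tangent. Positive cone
width therefore gives every portion of `𝓕` a unit direction `w` such that curves arbitrarily close
to linear with velocity `w` meet the portion in positive measure (`exists_isDirection`). By
compactness of the sphere, each portion contains a smaller one whose portions all have directions
near one fixed vector, to any precision and without moving far from the previous vector
(`HasDirectionsNear.refine`).

Residuality gives open sets `O n`, dense in `𝓕`, with `𝓕 ∩ ⋂ n, O n` inside the target set. Take one
almost linear curve. Its parameters over `𝓕` contain a compact `K` of positive measure, and disjoint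
intervals off `K`, centred at other such parameters, accumulate at all of `K`. Near the centre of
each interval, replace the curve by one passing through the next `O n` with half the directional
error. The old and new velocities differ by a multiple of the current error, so a bump with a
comparable Lipschitz constant interpolates between them. Iteration produces a tree
(`exists_isNodeTree`); the constants decay geometrically, so the bumps add up to a curve that is
left unchanged over every `K` (`IsNodeTree.exists_curve`).

Let `F` be the closure of the union of all the sets `K`. The cores of each generation form an open
set that is dense in `F`. A parameter lying in cores of all generations has almost constant unit
velocity around it, and its image is in `𝓕` and in every `O n` (`exists_nearLinear_curve`). Arc
length near `F`, with a slowdown elsewhere that keeps the curve in the cube, gives the required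
parametrization (`exists_reparametrization`). -/

/-! ### Curves with almost constant velocity -/

section Directions

variable {V : Type*} [NormedAddCommGroup V] [NormedSpace ℝ V]

/-- `g` deviates from uniform motion with velocity `v` by an `ε`-Lipschitz function on `J`. -/
def NearLinearOn (g : ℝ → V) (v : V) (ε : ℝ) (J : Set ℝ) : Prop :=
  ∀ s ∈ J, ∀ t ∈ J, ‖g s - g t - (s - t) • v‖ ≤ ε * |s - t|

theorem NearLinearOn.mono {g : ℝ → V} {v : V} {ε : ℝ} {J J' : Set ℝ}
    (h : NearLinearOn g v ε J) (hJ : J' ⊆ J) : NearLinearOn g v ε J' :=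
  fun s hs t ht => h s (hJ hs) t (hJ ht)

theorem NearLinearOn.change {g : ℝ → V} {v w : V} {ε δ ε' : ℝ} {J : Set ℝ}
    (h : NearLinearOn g v ε J) (hvw : ‖v - w‖ ≤ δ) (hε : ε + δ ≤ ε') : NearLinearOn g w ε' J := by
  intro s hs t ht
  have e : g s - g t - (s - t) • w = (g s - g t - (s - t) • v) + (s - t) • (v - w) := by
    rw [smul_sub]; abel
  rw [e]
  have h1 := h s hs t ht
  have h2 : ‖(s - t) • (v - w)‖ ≤ |s - t| * δ := by
    rw [norm_smul, Real.norm_eq_abs]; gcongr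
  have h3 := abs_nonneg (s - t)
  nlinarith [norm_add_le (g s - g t - (s - t) • v) ((s - t) • (v - w))]

theorem NearLinearOn.upper {g : ℝ → V} {v : V} {ε : ℝ} {J : Set ℝ} (h : NearLinearOn g v ε J)
    (hv : ‖v‖ = 1) {s t : ℝ} (hs : s ∈ J) (ht : t ∈ J) : ‖g s - g t‖ ≤ (1 + ε) * |s - t| := by
  have h1 := h s hs t ht
  have h2 : ‖(s - t) • v‖ = |s - t| := by rw [norm_smul, Real.norm_eq_abs, hv, mul_one]
  have h3 := norm_add_le (g s - g t - (s - t) • v) ((s - t) • v)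
  rw [sub_add_cancel] at h3
  linarith

theorem NearLinearOn.lower {g : ℝ → V} {v : V} {ε : ℝ} {J : Set ℝ} (h : NearLinearOn g v ε J)
    (hv : ‖v‖ = 1) {s t : ℝ} (hs : s ∈ J) (ht : t ∈ J) : (1 - ε) * |s - t| ≤ ‖g s - g t‖ := by
  have h1 := h s hs t ht
  have h2 : ‖(s - t) • v‖ = |s - t| := by rw [norm_smul, Real.norm_eq_abs, hv, mul_one]
  have h3 := norm_sub_le (g s - g t) (g s - g t - (s - t) • v)
  rw [sub_sub_cancel, h2] at h3
  linarith

theorem NearLinearOn.continuous {g : ℝ → V} {v : V} {ε : ℝ} (hε : 0 ≤ ε)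
    (h : NearLinearOn g v ε univ) (hv : ‖v‖ = 1) : Continuous g := by
  have : LipschitzWith (Real.toNNReal (1 + ε)) g := by
    refine LipschitzWith.of_dist_le_mul fun s t => ?_
    rw [dist_eq_norm, Real.dist_eq, Real.coe_toNNReal _ (by linarith)]
    exact h.upper hv (mem_univ _) (mem_univ _)
  exact this.continuous

/-- `w` is the direction of curves which are as close to linear as desired and meet `U ∩ 𝓕`,
at parameter zero, in a set of parameters with locally positive measure. -/
def IsDirection (𝓕 U : Set V) (w : V) : Prop :=
  ‖w‖ = 1 ∧ ∀ η : ℝ, 0 < η → ∃ g : ℝ → V, NearLinearOn g w η univ ∧ g 0 ∈ U ∩ 𝓕 ∧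
    ∀ δ : ℝ, 0 < δ → 0 < volume (Ioo (-δ) δ ∩ g ⁻¹' (U ∩ 𝓕))

theorem IsDirection.mono {𝓕 U U' : Set V} {w : V} (h : IsDirection 𝓕 U w) (hU : U ⊆ U') :
    IsDirection 𝓕 U' w := by
  refine ⟨h.1, fun η hη => ?_⟩
  obtain ⟨g, hg, h0, hδ⟩ := h.2 η hη
  refine ⟨g, hg, ⟨hU h0.1, h0.2⟩, fun δ hδ' => (hδ δ hδ').trans_le (measure_mono ?_)⟩
  exact fun x hx => ⟨hx.1, hU hx.2.1, hx.2.2⟩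

/-- Each portion of `𝓕` inside `U` has a direction within `ε` of the unit vector `v`. -/
structure HasDirectionsNear (𝓕 U : Set V) (v : V) (ε : ℝ) : Prop where
  isOpen : IsOpen U
  nonempty : (U ∩ 𝓕).Nonempty
  norm_eq : ‖v‖ = 1
  exists_direction : ∀ U' ⊆ U, IsOpen U' → (U' ∩ 𝓕).Nonempty →
    ∃ w, IsDirection 𝓕 U' w ∧ ‖w - v‖ ≤ ε

/-- Take a finite `ε'`-net of the unit vectors within `ε` of `v`. If no centre worked, one could
shrink the portion once per centre, each time losing all directions near that centre. The last
portion still has a direction within `ε` of `v`, which the net must catch. -/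
theorem HasDirectionsNear.refine [FiniteDimensional ℝ V] {𝓕 U : Set V} {v : V} {ε ε' : ℝ}
    (h : HasDirectionsNear 𝓕 U v ε) (hε' : 0 < ε') {U₀ : Set V} (hU₀ : U₀ ⊆ U)
    (ho : IsOpen U₀) (hne : (U₀ ∩ 𝓕).Nonempty) :
    ∃ U' ⊆ U₀, ∃ v', ‖v' - v‖ ≤ ε ∧ HasDirectionsNear 𝓕 U' v' ε' := by
  have : ProperSpace V := FiniteDimensional.proper ℝ V
  obtain ⟨T, hT, hfin, hcov⟩ := ((isCompact_sphere (0 : V) 1).inter_right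
    (Metric.isClosed_closedBall (x := v) (ε := ε))).finite_cover_balls hε'
  by_contra! hno
  have key : ∃ U₁ ⊆ U₀, IsOpen U₁ ∧ (U₁ ∩ 𝓕).Nonempty ∧
      ∀ v' ∈ T, ∀ w, IsDirection 𝓕 U₁ w → ε' < ‖w - v'‖ := by
    clear hcov
    induction T, hfin using Set.Finite.induction_on with
    | empty => exact ⟨U₀, Subset.rfl, ho, hne, by simp⟩
    | @insert a S ha hS ih =>
      obtain ⟨U₁, h1, h2, h3, h4⟩ := ih ((subset_insert _ _).trans hT)
      have haT := hT (mem_insert a S)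
      have hna : ‖a‖ = 1 := by simpa using haT.1
      have hav : ‖a - v‖ ≤ ε := by simpa [dist_eq_norm] using haT.2
      have hbad := hno U₁ h1 a hav
      have : ∃ U₂ ⊆ U₁, IsOpen U₂ ∧ (U₂ ∩ 𝓕).Nonempty ∧
          ∀ w, IsDirection 𝓕 U₂ w → ε' < ‖w - a‖ := by
        by_contra! hc
        exact hbad ⟨h2, h3, hna, fun U' hU' ho' hn' => hc U' hU' ho' hn'⟩
      obtain ⟨U₂, k1, k2, k3, k4⟩ := this
      refine ⟨U₂, k1.trans h1, k2, k3, fun v' hv' w hw => ?_⟩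
      rcases hv' with rfl | hv'
      · exact k4 w hw
      · exact h4 v' hv' w (hw.mono k1)
  obtain ⟨U₁, h1, h2, h3, h4⟩ := key
  obtain ⟨w, hw, hwv⟩ := h.exists_direction U₁ (h1.trans hU₀) h2 h3
  have hwm : w ∈ Metric.sphere (0 : V) 1 ∩ Metric.closedBall v ε := by
    simp [hw.1, dist_eq_norm, hwv]
  obtain ⟨v', hv', hb⟩ := mem_iUnion₂.1 (hcov hwm)
  have := h4 v' hv' w hw
  rw [Metric.mem_ball, dist_eq_norm] at hb
  linarith

end Directions

/-! ### Tangent directions of regular curves -/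

/-- A regular `C¹` curve meeting `U ∩ 𝓕` in positive measure yields a direction. -/
theorem exists_isDirection {d : ℕ} {𝓕 U : Set (EuclideanSpace ℝ (Fin d))}
    {ν : ℝ → EuclideanSpace ℝ (Fin d)} (hν : IsRegularC1Curve ν)
    (hpos : 0 < volume (Icc (0 : ℝ) 1 ∩ ν ⁻¹' (U ∩ 𝓕))) : ∃ w, IsDirection 𝓕 U w := by
  -- All neighbourhoods of `t₀` meet the parameter set in positive measure; the direction is the
  -- normalized tangent at `t₀`.
  obtain ⟨t₀, ht₀, hloc⟩ := exists_mem_forall_mem_nhdsWithin_pos_measure hpos.ne'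
  set S := Icc (0 : ℝ) 1 ∩ ν ⁻¹' (U ∩ 𝓕) with hS
  set w₀ := derivWithin ν (Icc 0 1) t₀ with hw₀
  have hne : w₀ ≠ 0 := hν.deriv_ne_zero t₀ ht₀.1
  have hnp : 0 < ‖w₀‖ := norm_pos_iff.2 hne
  refine ⟨‖w₀‖⁻¹ • w₀, by rw [norm_smul, norm_inv, norm_norm, inv_mul_cancel₀ hnp.ne'], ?_⟩
  intro η hη
  have hcont : ContinuousOn (derivWithin ν (Icc 0 1)) (Icc 0 1) :=
    hν.contDiffOn.continuousOn_derivWithin (uniqueDiffOn_Icc zero_lt_one) le_rfl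
  have hdiff : DifferentiableOn ℝ ν (Icc 0 1) := hν.contDiffOn.differentiableOn (by simp)
  obtain ⟨δ, hδ, hδ'⟩ := Metric.continuousOn_iff.1 hcont t₀ ht₀.1 (η * ‖w₀‖) (by positivity)
  set a := max 0 (t₀ - δ / 2)
  set b := min 1 (t₀ + δ / 2)
  have hab : a ≤ t₀ ∧ t₀ ≤ b := by
    constructor
    · exact max_le ht₀.1.1 (by linarith)
    · exact le_min ht₀.1.2 (by linarith)
  have hsub : ∀ x ∈ Icc a b, x ∈ Icc (0 : ℝ) 1 ∧ |x - t₀| < δ := by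
    intro x hx
    have h1 := (max_le_iff.1 hx.1)
    have h2 := (le_min_iff.1 hx.2)
    exact ⟨⟨h1.1, h2.1⟩, abs_lt.2 ⟨by linarith, by linarith⟩⟩
  have hnear : ∀ x ∈ Icc a b, ∀ y ∈ Icc a b,
      ‖ν x - ν y - (x - y) • w₀‖ ≤ η * ‖w₀‖ * |x - y| := by
    intro x hx y hy
    have hd : ∀ z ∈ Icc a b, HasDerivWithinAt (fun z => ν z - z • w₀)
        (derivWithin ν (Icc 0 1) z - w₀) (Icc a b) z := by
      intro z hz
      have h1 := ((hdiff z (hsub z hz).1).hasDerivWithinAt).mono (fun u hu => (hsub u hu).1)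
      have h2 := h1.sub ((hasDerivWithinAt_id z (Icc a b)).smul_const w₀)
      rw [one_smul] at h2
      exact h2
    have h2 := (convex_Icc a b).norm_image_sub_le_of_norm_hasDerivWithin_le hd
      (C := η * ‖w₀‖) (fun z hz => by
        have := hδ' z (hsub z hz).1 (by rw [Real.dist_eq]; exact (hsub z hz).2)
        rw [dist_eq_norm] at this
        exact this.le) hy hx
    rw [Real.norm_eq_abs] at h2
    have e : ν x - ν y - (x - y) • w₀ = ν x - x • w₀ - (ν y - y • w₀) := by
      rw [sub_smul]; abel
    rw [e]
    exact h2
  set P : ℝ → ℝ := fun s => max a (min b s) with hP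
  have hPm : ∀ s, P s ∈ Icc a b := fun s =>
    ⟨le_max_left _ _, max_le (hab.1.trans hab.2) (min_le_left _ _)⟩
  have hPl : ∀ s t, |P s - P t| ≤ |s - t| := fun s t => by
    calc |P s - P t| ≤ |min b s - min b t| := by
          simpa using abs_max_sub_max_le_abs (min b s) (min b t) a |>.trans_eq' (by
            simp only [hP]; rw [max_comm a, max_comm a])
      _ ≤ |s - t| := by
          have := abs_min_sub_min_le_max b s b t
          simpa using this
  have hPid : ∀ s ∈ Icc a b, P s = s := fun s hs => by
    simp only [hP]; rw [min_eq_right hs.2, max_eq_right hs.1]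
  -- Outside `[a, b]` the curve continues with velocity exactly `w₀`, so the local estimate becomes
  -- global.
  set g₁ : ℝ → EuclideanSpace ℝ (Fin d) := fun s => ν (P s) - P s • w₀ + s • w₀ with hg₁
  have hg₁' : ∀ s ∈ Icc a b, g₁ s = ν s := fun s hs => by simp [hg₁, hPid s hs]
  have hg₁l : ∀ s t, ‖g₁ s - g₁ t - (s - t) • w₀‖ ≤ η * ‖w₀‖ * |s - t| := by
    intro s t
    have e : g₁ s - g₁ t - (s - t) • w₀ = ν (P s) - ν (P t) - (P s - P t) • w₀ := by
      simp only [hg₁, sub_smul]; abel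
    rw [e]
    exact (hnear _ (hPm s) _ (hPm t)).trans
      (mul_le_mul_of_nonneg_left (hPl s t) (by positivity))
  refine ⟨fun u => g₁ (‖w₀‖⁻¹ * u + t₀), ?_, ?_, ?_⟩
  · intro s _ t _
    have := hg₁l (‖w₀‖⁻¹ * s + t₀) (‖w₀‖⁻¹ * t + t₀)
    have e : ‖w₀‖⁻¹ * s + t₀ - (‖w₀‖⁻¹ * t + t₀) = ‖w₀‖⁻¹ * (s - t) := by ring
    rw [e, abs_mul, abs_of_pos (inv_pos.2 hnp)] at this
    rw [smul_smul, mul_comm (s - t)]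
    refine this.trans_eq ?_
    field_simp
  · simp only [mul_zero, zero_add]
    rw [hg₁' t₀ hab]
    exact ht₀.2
  · intro ρ hρ
    set ρ' := min (ρ * ‖w₀‖⁻¹) (δ / 2) with hρ'
    have hρ'0 : 0 < ρ' := lt_min (by positivity) (by positivity)
    have hp : 0 < volume (Ioo (t₀ - ρ') (t₀ + ρ') ∩ S) := by
      refine hloc _ ?_
      rw [inter_comm]
      exact inter_mem_nhdsWithin _ (Ioo_mem_nhds (by linarith) (by linarith))
    have hsubset : (fun x => ‖w₀‖⁻¹ * x) ⁻¹' ((fun x => x + t₀) ⁻¹'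
        (Ioo (t₀ - ρ') (t₀ + ρ') ∩ S)) ⊆
        Ioo (-ρ) ρ ∩ (fun u => g₁ (‖w₀‖⁻¹ * u + t₀)) ⁻¹' (U ∩ 𝓕) := by
      rintro x ⟨hx, hxS⟩
      have h1 : ρ' ≤ ρ * ‖w₀‖⁻¹ := min_le_left _ _
      have h2 : ρ' ≤ δ / 2 := min_le_right _ _
      have hi : 0 < ‖w₀‖⁻¹ := inv_pos.2 hnp
      simp only [mem_Ioo] at hx
      refine ⟨⟨?_, ?_⟩, ?_⟩
      · have : ‖w₀‖⁻¹ * (-ρ) < ‖w₀‖⁻¹ * x := by linarith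
        exact lt_of_mul_lt_mul_left this hi.le
      · have : ‖w₀‖⁻¹ * x < ‖w₀‖⁻¹ * ρ := by linarith
        exact lt_of_mul_lt_mul_left this hi.le
      · have hm : ‖w₀‖⁻¹ * x + t₀ ∈ Icc a b :=
          ⟨max_le hxS.1.1 (by linarith), le_min hxS.1.2 (by linarith)⟩
        simp only [mem_preimage]
        rw [hg₁' _ hm]
        exact hxS.2
    refine lt_of_lt_of_le ?_ (measure_mono hsubset)
    rw [Real.volume_preimage_mul_left (inv_pos.2 hnp).ne', measure_preimage_add_right]
    exact ENNReal.mul_pos (by simpa using hne) hp.ne'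

/-! ### Vitali families and Lipschitz bumps -/

/-- Inside a set of positive measure there are a compact set of positive measure and disjoint
intervals, centred in the set, off the compact set and accumulating at each of its points. -/
theorem exists_compact_and_accumulating_intervals {P : Set ℝ} (hP : MeasurableSet P)
    (hpos : 0 < volume P) {c ρ : ℝ} (hPW : P ⊆ Metric.ball c ρ) :
    ∃ K ⊆ P, 0 < volume K ∧ ∃ S ⊆ P, ∃ R : ℝ → ℝ, (∀ q ∈ S, 0 < R q) ∧
      (∀ q ∈ S, Metric.closedBall q (R q) ⊆ Metric.ball c ρ) ∧
      (∀ q ∈ S, Disjoint K (Metric.closedBall q (R q))) ∧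
      S.PairwiseDisjoint (fun q => Metric.closedBall q (R q)) ∧
      ∀ t ∈ K, ∀ δ : ℝ, 0 < δ → ∃ q ∈ S, Metric.closedBall q (R q) ⊆ Metric.ball t δ := by
  -- `K` will avoid the null set `Q`, so `Q` supplies points of `P \ K` arbitrarily near each point
  -- of `K`.
  obtain ⟨Q, hQP, hQc, hQd⟩ :=
    (TopologicalSpace.IsSeparable.of_separableSpace P).exists_countable_dense_subset
  have hpos' : 0 < volume (P \ Q) := by
    rwa [measure_sdiff_null (hQc.measure_zero volume)]
  obtain ⟨K, hKP, hK, hKpos⟩ := (hP.diff hQc.measurableSet).exists_lt_isCompact hpos'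
  have hKne : K.Nonempty := by
    by_contra h
    rw [not_nonempty_iff_eq_empty] at h
    simp [h] at hKpos
  have hKP' : K ⊆ P := hKP.trans sdiff_subset
  -- The factor 10 beats the Vitali enlargement 5: if the enlarged ball about `b` contains `q`, then
  -- `5 * R b` is at most the distance from `q` to `K`. Selected balls thus accumulate wherever the
  -- points of `Q` do.
  set R : ℝ → ℝ := fun q => min (Metric.infDist q K) (ρ - dist q c) / 10 with hR
  obtain ⟨u, hut, hud, hucov⟩ := Vitali.exists_disjoint_subfamily_covering_enlargement_closedBall
    (P \ K) id R (ρ / 10) (fun a _ => by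
      have h1 : min (Metric.infDist a K) (ρ - dist a c) ≤ ρ - dist a c := min_le_right _ _
      have h2 := dist_nonneg (x := a) (y := c)
      simp only [hR]
      linarith) 5 (by norm_num)
  have hpt : ∀ q ∈ P \ K, 0 < R q := by
    intro q hq
    refine div_pos (lt_min ?_ ?_) (by norm_num)
    · exact (hK.isClosed.notMem_iff_infDist_pos hKne).1 hq.2
    · have := hPW hq.1
      rw [Metric.mem_ball] at this
      linarith
  have hRd : ∀ q, 10 * R q ≤ Metric.infDist q K := fun q => by
    have : min (Metric.infDist q K) (ρ - dist q c) ≤ Metric.infDist q K := min_le_left _ _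
    simp only [hR]; linarith
  refine ⟨K, hKP', hKpos, u, fun q hq => (hut hq).1, R, fun q hq => hpt q (hut hq), ?_, ?_, hud, ?_⟩
  · intro q hq x hx
    have h0 := hpt q (hut hq)
    have h1 : min (Metric.infDist q K) (ρ - dist q c) ≤ ρ - dist q c := min_le_right _ _
    have h2 : 10 * R q ≤ ρ - dist q c := by simp only [hR]; linarith
    rw [Metric.mem_closedBall] at hx
    rw [Metric.mem_ball]
    linarith [dist_triangle x q c]
  · intro q hq
    rw [disjoint_left]
    intro x hxK hx
    have h0 := hpt q (hut hq)
    have h1 := Metric.infDist_le_dist_of_mem (x := q) hxK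
    rw [Metric.mem_closedBall, dist_comm] at hx
    linarith [hRd q]
  · intro t ht δ hδ
    obtain ⟨q, hqQ, hqt⟩ := Metric.mem_closure_iff.1 (hQd (hKP' ht)) (δ / 4) (by positivity)
    have hqPK : q ∈ P \ K := ⟨hQP hqQ, fun h => (hKP h).2 hqQ⟩
    obtain ⟨b, hb, hcov⟩ := hucov q hqPK
    have hqb := hcov (Metric.mem_closedBall_self (hpt q hqPK).le)
    simp only [id, Metric.mem_closedBall] at hqb
    refine ⟨b, hb, fun x hx => ?_⟩
    have h1 := Metric.infDist_le_dist_of_mem (x := b) ht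
    have h2 := Metric.infDist_le_dist_of_mem (x := q) ht
    have h3 := Metric.infDist_le_infDist_add_dist (s := K) (x := b) (y := q)
    rw [dist_comm b q] at h3
    have h4 := hRd b
    rw [Metric.mem_closedBall] at hx
    rw [Metric.mem_ball]
    rw [dist_comm] at hqt
    linarith [dist_triangle x b t, dist_triangle b q t, dist_comm b q, hpt b (hut hb)]

/-- Multiplying a Lipschitz map that is small at `q` by a cutoff function. -/
theorem exists_cutoff {V : Type*} [NormedAddCommGroup V] [NormedSpace ℝ V] {D : ℝ → V}
    {q R L η : ℝ} (hR : 0 < R) (hD : ∀ s t, ‖D s - D t‖ ≤ L * |s - t|) (hη : ‖D q‖ ≤ η * R) :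
    ∃ φ : ℝ → V, (∀ s t, ‖φ s - φ t‖ ≤ (2 * η + 3 * L) * |s - t|) ∧
      (∀ t, t ∉ Metric.closedBall q R → φ t = 0) ∧
      ∀ t ∈ Metric.closedBall q (R / 2), φ t = D t := by
  set χ : ℝ → ℝ := fun t => max 0 (min 1 (2 - 2 / R * |t - q|)) with hχ
  have hχ0 : ∀ t, 0 ≤ χ t := fun t => le_max_left _ _
  have hχ1 : ∀ t, χ t ≤ 1 := fun t => max_le zero_le_one (min_le_left _ _)
  have hχl : ∀ s t, |χ s - χ t| ≤ 2 / R * |s - t| := by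
    intro s t
    calc |χ s - χ t| ≤ |min 1 (2 - 2 / R * |s - q|) - min 1 (2 - 2 / R * |t - q|)| := by
          simpa using abs_max_sub_max_le_max 0 (min 1 (2 - 2 / R * |s - q|)) 0
            (min 1 (2 - 2 / R * |t - q|))
      _ ≤ |(2 - 2 / R * |s - q|) - (2 - 2 / R * |t - q|)| := by
          simpa using abs_min_sub_min_le_max 1 (2 - 2 / R * |s - q|) 1 (2 - 2 / R * |t - q|)
      _ = 2 / R * |(|t - q| - |s - q|)| := by
          have e : (2 - 2 / R * |s - q|) - (2 - 2 / R * |t - q|) =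
            2 / R * (|t - q| - |s - q|) := by ring
          rw [e, abs_mul, abs_of_pos (show 0 < 2 / R by positivity)]
      _ ≤ 2 / R * |s - t| := by
          refine mul_le_mul_of_nonneg_left ?_ (by positivity)
          have := abs_abs_sub_abs_le_abs_sub (t - q) (s - q)
          rw [abs_sub_comm s t]
          simpa using this
  have hL : 0 ≤ L := by
    have := (norm_nonneg _).trans (hD 1 0)
    simpa using this
  have hη0 : 0 ≤ η := by
    have := (norm_nonneg _).trans hη
    exact nonneg_of_mul_nonneg_left this hR
  have hout : ∀ t, t ∉ Metric.closedBall q R → χ t = 0 := by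
    intro t ht
    rw [Metric.mem_closedBall, Real.dist_eq, not_le] at ht
    refine max_eq_left ((min_le_right _ _).trans ?_)
    have : 2 / R * R ≤ 2 / R * |t - q| := by gcongr
    rw [div_mul_cancel₀ _ hR.ne'] at this
    linarith
  -- Product rule: slope `2 / R` times the size `(η + L) * R` of `D` on the ball, plus `L`. Having
  -- one point in the ball is enough.
  have half : ∀ s t, s ∈ Metric.closedBall q R →
      ‖χ s • D s - χ t • D t‖ ≤ (2 * η + 3 * L) * |s - t| := by
    intro s t hs
    rw [Metric.mem_closedBall, Real.dist_eq] at hs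
    have e : χ s • D s - χ t • D t = (χ s - χ t) • D s + χ t • (D s - D t) := by
      rw [sub_smul, smul_sub]; abel
    have h1 : ‖D s‖ ≤ (η + L) * R := by
      have h2 := norm_add_le (D s - D q) (D q)
      rw [sub_add_cancel] at h2
      have h3 := hD s q
      nlinarith
    rw [e]
    calc _ ≤ |χ s - χ t| * ‖D s‖ + χ t * ‖D s - D t‖ := by
          refine (norm_add_le _ _).trans_eq ?_
          rw [norm_smul, norm_smul, Real.norm_eq_abs, Real.norm_eq_abs, abs_of_nonneg (hχ0 t)]
      _ ≤ (2 / R * |s - t|) * ((η + L) * R) + 1 * (L * |s - t|) := by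
          gcongr
          · exact hχl s t
          · exact hχ1 t
          · exact hD s t
      _ = (2 * η + 3 * L) * |s - t| := by field_simp; ring
  refine ⟨fun t => χ t • D t, fun s t => ?_, fun t ht => by simp [hout t ht], fun t ht => ?_⟩
  · by_cases hs : s ∈ Metric.closedBall q R
    · exact half s t hs
    by_cases ht : t ∈ Metric.closedBall q R
    · have := half t s ht
      rwa [norm_sub_rev, abs_sub_comm] at this
    · simp only [hout s hs, hout t ht, zero_smul, sub_zero, norm_zero]
      positivity
  · have : χ t = 1 := by
      rw [Metric.mem_closedBall, Real.dist_eq] at ht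
      have h2 : 2 / R * |t - q| ≤ 2 / R * (R / 2) := by gcongr
      have h3 : 2 / R * (R / 2) = 1 := by field_simp
      simp only [hχ]
      rw [min_eq_left (by linarith), max_eq_right zero_le_one]
    simp [this]

/-- Superposition of Lipschitz bumps with disjoint supports. -/
theorem exists_superposition {V ι : Type*} [NormedAddCommGroup V] {S : Set ι} {φ : ι → ℝ → V}
    {O : ι → Set ℝ} {L : ℝ} (hL : 0 ≤ L) (hφ : ∀ i ∈ S, ∀ s t, ‖φ i s - φ i t‖ ≤ L * |s - t|)
    (hO : ∀ i ∈ S, ∀ t, t ∉ O i → φ i t = 0)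
    (hdisj : ∀ i ∈ S, ∀ j ∈ S, ∀ t, t ∈ O i → t ∈ O j → i = j) :
    ∃ Φ : ℝ → V, (∀ s t, ‖Φ s - Φ t‖ ≤ 2 * L * |s - t|) ∧
      (∀ i ∈ S, ∀ t ∈ O i, Φ t = φ i t) ∧ ∀ t, (∀ i ∈ S, t ∉ O i) → Φ t = 0 := by
  classical
  set Φ : ℝ → V := fun t => if h : ∃ i ∈ S, t ∈ O i then φ h.choose t else 0 with hΦ
  have h1 : ∀ i ∈ S, ∀ t ∈ O i, Φ t = φ i t := by
    intro i hi t ht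
    have h : ∃ i ∈ S, t ∈ O i := ⟨i, hi, ht⟩
    simp only [hΦ, dif_pos h]
    rw [hdisj _ h.choose_spec.1 i hi t h.choose_spec.2 ht]
  have h2 : ∀ t, (∀ i ∈ S, t ∉ O i) → Φ t = 0 := by
    intro t ht
    have h : ¬ ∃ i ∈ S, t ∈ O i := by push Not; exact ht
    simp only [hΦ, dif_neg h]
  -- Between two different supports each bump is controlled separately by its vanishing at the other
  -- point; this costs the factor 2.
  have h3 : ∀ i ∈ S, ∀ s t, s ∈ O i → t ∉ O i → ‖φ i s‖ ≤ L * |s - t| := by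
    intro i hi s t _ ht
    simpa [hO i hi t ht] using hφ i hi s t
  refine ⟨Φ, fun s t => ?_, h1, h2⟩
  have hnn : 0 ≤ L * |s - t| := by positivity
  by_cases hs : ∃ i ∈ S, s ∈ O i <;> by_cases ht : ∃ j ∈ S, t ∈ O j
  · obtain ⟨i, hi, his⟩ := hs
    obtain ⟨j, hj, hjt⟩ := ht
    rw [h1 i hi s his, h1 j hj t hjt]
    by_cases hij : i = j
    · subst hij
      linarith [hφ i hi s t]
    · have ha := h3 i hi s t his fun h => hij (hdisj i hi j hj t h hjt)
      have hb := h3 j hj t s hjt fun h => hij (hdisj i hi j hj s his h)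
      rw [abs_sub_comm] at hb
      linarith [norm_sub_le (φ i s) (φ j t)]
  · obtain ⟨i, hi, his⟩ := hs
    push Not at ht
    rw [h1 i hi s his, h2 t ht, sub_zero]
    linarith [h3 i hi s t his (ht i hi)]
  · obtain ⟨j, hj, hjt⟩ := ht
    push Not at hs
    rw [h1 j hj t hjt, h2 s hs, zero_sub, norm_neg]
    have hb := h3 j hj t s hjt (hs j hj)
    rw [abs_sub_comm] at hb
    linarith
  · push Not at hs ht
    rw [h2 s hs, h2 t ht, sub_zero, norm_zero]
    linarith

/-! ### Trees of nested modifications of a curve -/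

section Trees

variable {V : Type*} [NormedAddCommGroup V] [NormedSpace ℝ V]

/-- A modification of a curve: the bump `φ` is supported in the interval `q ± R`, and on the core
`q ± r` the modified curve agrees with `g`, which has almost constant velocity `v` and meets
`U ∩ 𝓕`. -/
structure CurveNode (V : Type*) where
  q : ℝ
  R : ℝ
  r : ℝ
  ε : ℝ
  v : V
  U : Set V
  g : ℝ → V
  φ : ℝ → V

/-- The interval supporting the bump. -/
def CurveNode.outer (x : CurveNode V) : Set ℝ := Metric.closedBall x.q x.R

/-- The interval on which the modified curve agrees with `x.g`. -/
def CurveNode.core (x : CurveNode V) : Set ℝ := Metric.ball x.q x.r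

/-- The geometric requirements on a single node. -/
structure CurveNode.Valid (𝓕 : Set V) (x : CurveNode V) : Prop where
  r_pos : 0 < x.r
  r_le : x.r ≤ x.R / 2
  ε_pos : 0 < x.ε
  nearLinear : NearLinearOn x.g x.v (2 * x.ε) univ
  directions : HasDirectionsNear 𝓕 x.U x.v x.ε
  volume_pos : 0 < volume (x.core ∩ x.g ⁻¹' (x.U ∩ 𝓕))

/-- `z` modifies, inside the core of `x`, a curve that agrees there with `x.g`, and its core is
mapped into `O` even after further modifications. -/
structure CurveNode.IsChild (O : Set V) (x z : CurveNode V) : Prop where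
  ε_eq : z.ε = x.ε / 2
  outer_subset : z.outer ⊆ x.core
  lip : ∀ s t, ‖z.φ s - z.φ t‖ ≤ 14 * x.ε * |s - t|
  eq_zero : ∀ t, t ∉ z.outer → z.φ t = 0
  eq_sub : ∀ t ∈ z.core, z.φ t = z.g t - x.g t
  ball_subset : Metric.closedBall (z.g z.q) (6 * z.r) ⊆ O

theorem CurveNode.Valid.core_subset_outer {𝓕 : Set V} {x : CurveNode V} (h : x.Valid 𝓕) :
    x.core ⊆ x.outer := by
  refine Metric.ball_subset_closedBall.trans (Metric.closedBall_subset_closedBall ?_)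
  linarith [h.r_le, h.r_pos]

theorem CurveNode.IsChild.r_le {𝓕 O : Set V} {x z : CurveNode V} (h : x.IsChild O z)
    (hz : z.Valid 𝓕) : z.r ≤ x.r / 2 := by
  have hR : 0 < z.R := by linarith [hz.r_le, hz.r_pos]
  have h1 : z.q + z.R ∈ x.core := h.outer_subset (by
    simp [CurveNode.outer, abs_of_pos hR])
  have h2 : z.q - z.R ∈ x.core := h.outer_subset (by
    simp [CurveNode.outer, abs_of_pos hR])
  rw [CurveNode.core, Metric.mem_ball, Real.dist_eq, abs_lt] at h1 h2
  linarith [hz.r_le, h1.2, h2.1]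

/-- One `ε` comes from the direction, the other from the curve's deviation from that direction. -/
theorem HasDirectionsNear.exists_curve {𝓕 U : Set V} {v : V} {ε : ℝ}
    (h : HasDirectionsNear 𝓕 U v ε) (hε : 0 < ε) (q : ℝ) :
    ∃ g : ℝ → V, NearLinearOn g v (2 * ε) univ ∧ g q ∈ U ∩ 𝓕 ∧
      ∀ δ : ℝ, 0 < δ → 0 < volume (Metric.ball q δ ∩ g ⁻¹' (U ∩ 𝓕)) := by
  obtain ⟨w, hw, hwv⟩ := h.exists_direction U Subset.rfl h.isOpen h.nonempty
  obtain ⟨g, hg, h0, hδ⟩ := hw.2 ε hε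
  refine ⟨fun t => g (t - q), ?_, by simpa using h0, fun δ hδ' => ?_⟩
  · intro s _ t _
    have := hg.change hwv (show ε + ε ≤ 2 * ε by linarith) (s - q) (mem_univ _) (t - q) (mem_univ _)
    simpa using this
  · have h1 := hδ δ hδ'
    rw [← measure_preimage_add_right volume (-q)] at h1
    refine h1.trans_le (measure_mono ?_)
    rintro x ⟨hx, hxU⟩
    simp only [← sub_eq_add_neg] at hx hxU
    refine ⟨?_, hxU⟩
    rw [Metric.mem_ball, Real.dist_eq, abs_lt]
    exact hx

theorem CurveNode.Valid.exists_child [FiniteDimensional ℝ V] {𝓕 O : Set V} {x : CurveNode V}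
    (hx : x.Valid 𝓕) (hO : IsOpen O)
    (hOd : ∀ U, IsOpen U → (U ∩ 𝓕).Nonempty → (U ∩ O ∩ 𝓕).Nonempty) {q R : ℝ}
    (hq : x.g q ∈ x.U ∩ 𝓕) (hR : 0 < R) (hqR : Metric.closedBall q R ⊆ x.core) :
    ∃ z : CurveNode V, z.Valid 𝓕 ∧ x.IsChild O z ∧ z.q = q ∧ z.R = R := by
  have hε := hx.ε_pos
  -- Staying in `B` makes the jump at `q` small relative to `R`, as the cutoff requires.
  set B := Metric.ball (x.g q) (x.ε * R)
  have hBo : IsOpen (x.U ∩ B) := hx.directions.isOpen.inter Metric.isOpen_ball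
  obtain ⟨U', hU', v', hv', hd⟩ := hx.directions.refine (half_pos hε)
    (U₀ := x.U ∩ B ∩ O) (fun y hy => hy.1.1) (hBo.inter hO)
    (hOd _ hBo ⟨x.g q, ⟨hq.1, Metric.mem_ball_self (by positivity)⟩, hq.2⟩)
  obtain ⟨g, hg, hgq, hgpos⟩ := hd.exists_curve (half_pos hε) q
  obtain ⟨⟨-, hgB⟩, hgO⟩ := hU' hgq.1
  -- Both curves are within `2 * x.ε` of velocity `x.v`. The cutoff turns this into `2 * x.ε + 3 *
  -- (4 * x.ε) = 14 * x.ε`.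
  have hD : ∀ s t, ‖(g s - x.g s) - (g t - x.g t)‖ ≤ 4 * x.ε * |s - t| := by
    intro s t
    have h1 := hg.change hv' (le_refl _) s (mem_univ _) t (mem_univ _)
    have h2 := hx.nearLinear s (mem_univ _) t (mem_univ _)
    have e : (g s - x.g s) - (g t - x.g t) =
        (g s - g t - (s - t) • x.v) - (x.g s - x.g t - (s - t) • x.v) := by abel
    rw [e]
    refine (norm_sub_le _ _).trans ?_
    linarith
  have hDq : ‖g q - x.g q‖ ≤ x.ε * R := by
    rw [Metric.mem_ball, dist_eq_norm] at hgB
    exact hgB.le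
  obtain ⟨φ, hφ, hφ0, hφ1⟩ := exists_cutoff (D := fun t => g t - x.g t) hR hD hDq
  obtain ⟨ρ, hρ, hρO⟩ := Metric.nhds_basis_closedBall.mem_iff.1 (hO.mem_nhds hgO)
  have hr : 0 < min (R / 2) (ρ / 6) := lt_min (by positivity) (by positivity)
  refine ⟨⟨q, R, min (R / 2) (ρ / 6), x.ε / 2, v', U', g, φ⟩, ⟨hr, min_le_left _ _, half_pos hε,
    hg, hd, hgpos _ hr⟩, ⟨rfl, hqR, fun s t => ?_, hφ0, fun t ht => hφ1 t ?_, ?_⟩, rfl, rfl⟩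
  · exact (hφ s t).trans_eq (by ring)
  · exact Metric.ball_subset_closedBall.trans
      (Metric.closedBall_subset_closedBall (min_le_left _ _)) ht
  · refine (Metric.closedBall_subset_closedBall ?_).trans hρO
    have : min (R / 2) (ρ / 6) ≤ ρ / 6 := min_le_right _ _
    simp only
    linarith

theorem CurveNode.Valid.exists_children [FiniteDimensional ℝ V] {𝓕 O : Set V} {x : CurveNode V}
    (hx : x.Valid 𝓕) (h𝓕 : IsClosed 𝓕) (hO : IsOpen O)
    (hOd : ∀ U, IsOpen U → (U ∩ 𝓕).Nonempty → (U ∩ O ∩ 𝓕).Nonempty) :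
    ∃ (C : Set (CurveNode V)) (K : Set ℝ), (∀ z ∈ C, z.Valid 𝓕 ∧ x.IsChild O z) ∧
      K ⊆ x.core ∩ x.g ⁻¹' (x.U ∩ 𝓕) ∧ 0 < volume K ∧ (∀ z ∈ C, Disjoint K z.outer) ∧
      (∀ z ∈ C, ∀ z' ∈ C, ∀ t, t ∈ z.outer → t ∈ z'.outer → z = z') ∧
      ∀ t ∈ K, ∀ δ : ℝ, 0 < δ → ∃ z ∈ C, z.outer ⊆ Metric.ball t δ := by
  have hgc : Continuous x.g := hx.nearLinear.continuous (by linarith [hx.ε_pos])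
    hx.directions.norm_eq
  have hm : MeasurableSet (x.core ∩ x.g ⁻¹' (x.U ∩ 𝓕)) := by
    refine Metric.isOpen_ball.measurableSet.inter ?_
    rw [preimage_inter]
    exact (hx.directions.isOpen.preimage hgc).measurableSet.inter
      (h𝓕.preimage hgc).measurableSet
  obtain ⟨K, hKP, hK, S, hSP, R, hR, hRW, hKR, hSd, hacc⟩ :=
    exists_compact_and_accumulating_intervals hm hx.volume_pos inter_subset_left
  have hz : ∀ q ∈ S, ∃ z : CurveNode V, z.Valid 𝓕 ∧ x.IsChild O z ∧ z.q = q ∧ z.R = R q :=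
    fun q hq => hx.exists_child hO hOd (hSP hq).2 (hR q hq) (hRW q hq)
  have : Nonempty (CurveNode V) := ⟨x⟩
  choose! z hzv hzc hzq hzR using hz
  have hout : ∀ q ∈ S, (z q).outer = Metric.closedBall q (R q) := fun q hq => by
    rw [CurveNode.outer, hzq q hq, hzR q hq]
  refine ⟨z '' S, K, ?_, hKP, hK, ?_, ?_, ?_⟩
  · rintro _ ⟨q, hq, rfl⟩
    exact ⟨hzv q hq, hzc q hq⟩
  · rintro _ ⟨q, hq, rfl⟩
    rw [hout q hq]
    exact hKR q hq
  · rintro _ ⟨q, hq, rfl⟩ _ ⟨q', hq', rfl⟩ t ht ht'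
    rw [hout q hq] at ht
    rw [hout q' hq'] at ht'
    rw [hSd.elim_set hq hq' t ht ht']
  · intro t ht δ hδ
    obtain ⟨q, hq, h⟩ := hacc t ht δ hδ
    exact ⟨z q, mem_image_of_mem _ hq, by rwa [hout q hq]⟩

/-- `N n` is the `n`-th generation of a tree of nodes, and `K n x` is a set of parameters near
`x ∈ N n` which the modifications of later generations leave alone. -/
structure IsNodeTree (𝓕 : Set V) (O : ℕ → Set V) (root : CurveNode V) (N : ℕ → Set (CurveNode V))
    (K : ℕ → CurveNode V → Set ℝ) : Prop where
  zero : N 0 = {root}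
  valid : ∀ n, ∀ x ∈ N n, x.Valid 𝓕
  exists_parent : ∀ n, ∀ z ∈ N (n + 1), ∃ x ∈ N n, x.IsChild (O n) z
  eq_of_mem_outer : ∀ n, ∀ x ∈ N n, ∀ y ∈ N n, ∀ t, t ∈ x.outer → t ∈ y.outer → x = y
  K_subset : ∀ n, ∀ x ∈ N n, K n x ⊆ x.core ∩ x.g ⁻¹' (x.U ∩ 𝓕)
  K_pos : ∀ n, ∀ x ∈ N n, 0 < volume (K n x)
  K_disjoint : ∀ n, ∀ x ∈ N n, ∀ z ∈ N (n + 1), Disjoint (K n x) z.outer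
  accumulates : ∀ n, ∀ x ∈ N n, ∀ t ∈ K n x, ∀ δ : ℝ, 0 < δ →
    ∃ z ∈ N (n + 1), z.outer ⊆ Metric.ball t δ

theorem exists_isNodeTree [FiniteDimensional ℝ V] {𝓕 : Set V} {O : ℕ → Set V}
    {root : CurveNode V} (h𝓕 : IsClosed 𝓕) (hO : ∀ n, IsOpen (O n))
    (hOd : ∀ n U, IsOpen U → (U ∩ 𝓕).Nonempty → (U ∩ O n ∩ 𝓕).Nonempty)
    (hroot : root.Valid 𝓕) : ∃ N K, IsNodeTree 𝓕 O root N K := by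
  have := fun (n : ℕ) (x : CurveNode V) (hx : x.Valid 𝓕) =>
    hx.exists_children h𝓕 (hO n) (hOd n)
  choose! C K hC hK hKpos hKd hCd hacc using this
  set N : ℕ → Set (CurveNode V) := fun n => Nat.rec {root} (fun n S => ⋃ x ∈ S, C n x) n with hN
  have hmem : ∀ n z, z ∈ N (n + 1) ↔ ∃ x ∈ N n, z ∈ C n x := by
    intro n z
    change z ∈ ⋃ x ∈ N n, C n x ↔ _
    simp
  have hv : ∀ n, ∀ x ∈ N n, x.Valid 𝓕 := by
    intro n
    induction n with
    | zero => intro x hx; rw [show x = root from hx]; exact hroot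
    | succ n ih =>
      intro z hz
      obtain ⟨x, hx, hzx⟩ := (hmem n z).1 hz
      exact (hC n x (ih x hx) z hzx).1
  have hd : ∀ n, ∀ x ∈ N n, ∀ y ∈ N n, ∀ t, t ∈ x.outer → t ∈ y.outer → x = y := by
    intro n
    induction n with
    | zero =>
      intro x hx y hy _ _ _
      rw [show x = root from hx, show y = root from hy]
    | succ n ih =>
      intro z hz z' hz' t ht ht'
      obtain ⟨x, hx, hzx⟩ := (hmem n z).1 hz
      obtain ⟨x', hx', hzx'⟩ := (hmem n z').1 hz'
      have h1 := (hC n x (hv n x hx) z hzx).2.outer_subset ht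
      have h2 := (hC n x' (hv n x' hx') z' hzx').2.outer_subset ht'
      have := ih x hx x' hx' t ((hv n x hx).core_subset_outer h1)
        ((hv n x' hx').core_subset_outer h2)
      subst this
      exact hCd n x (hv n x hx) z hzx z' hzx' t ht ht'
  refine ⟨N, K, rfl, hv, fun n z hz => ?_, hd, fun n x hx => hK n x (hv n x hx),
    fun n x hx => hKpos n x (hv n x hx), fun n x hx z hz => ?_, fun n x hx t ht δ hδ => ?_⟩
  · obtain ⟨x, hx, hzx⟩ := (hmem n z).1 hz
    exact ⟨x, hx, (hC n x (hv n x hx) z hzx).2⟩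
  -- `z` need not be a child of `x`, but a common point would force its parent `y` to equal `x`.
  · obtain ⟨y, hy, hzy⟩ := (hmem n z).1 hz
    rw [disjoint_left]
    intro t ht htz
    have h1 := (hC n y (hv n y hy) z hzy).2.outer_subset htz
    have h2 := (hK n x (hv n x hx) ht).1
    have := hd n x hx y hy t ((hv n x hx).core_subset_outer h2)
      ((hv n y hy).core_subset_outer h1)
    subst this
    exact disjoint_left.1 (hKd n x (hv n x hx) z hzy) ht htz
  · obtain ⟨z, hz, h⟩ := hacc n x (hv n x hx) t ht δ hδ
    exact ⟨z, (hmem n z).2 ⟨x, hx, hz⟩, h⟩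

namespace IsNodeTree

variable {𝓕 : Set V} {O : ℕ → Set V} {root : CurveNode V} {N : ℕ → Set (CurveNode V)}
  {K : ℕ → CurveNode V → Set ℝ}

theorem ε_eq (T : IsNodeTree 𝓕 O root N K) (n : ℕ) : ∀ x ∈ N n, x.ε = root.ε * (1 / 2) ^ n := by
  induction n with
  | zero => intro x hx; rw [T.zero] at hx; rw [show x = root from hx]; simp
  | succ n ih =>
    intro z hz
    obtain ⟨x, hx, h⟩ := T.exists_parent n z hz
    rw [h.ε_eq, ih x hx]; ring

theorem r_le (T : IsNodeTree 𝓕 O root N K) (n : ℕ) : ∀ x ∈ N n, x.r ≤ root.r * (1 / 2) ^ n := by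
  induction n with
  | zero => intro x hx; rw [T.zero] at hx; rw [show x = root from hx]; simp
  | succ n ih =>
    intro z hz
    obtain ⟨x, hx, h⟩ := T.exists_parent n z hz
    have h1 := h.r_le (T.valid _ z hz)
    have h2 := ih x hx
    rw [pow_succ]; linarith

theorem exists_ancestor (T : IsNodeTree 𝓕 O root N K) (n j : ℕ) :
    ∀ z ∈ N (n + j), ∃ x ∈ N n, z.outer ⊆ x.outer := by
  induction j with
  | zero => exact fun z hz => ⟨z, hz, Subset.rfl⟩
  | succ j ih =>
    intro z hz
    obtain ⟨x, hx, h⟩ := T.exists_parent (n + j) z hz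
    obtain ⟨y, hy, h'⟩ := ih x hx
    exact ⟨y, hy, (h.outer_subset.trans (T.valid _ x hx).core_subset_outer).trans h'⟩

theorem notMem_outer_of_mem_K (T : IsNodeTree 𝓕 O root N K) {n m : ℕ} (hnm : n < m)
    {x z : CurveNode V} (hx : x ∈ N n) (hz : z ∈ N m) {t : ℝ} (ht : t ∈ K n x) : t ∉ z.outer := by
  obtain ⟨j, rfl⟩ := Nat.exists_eq_add_of_le (Nat.succ_le_of_lt hnm)
  obtain ⟨y, hy, h⟩ := T.exists_ancestor (n + 1) j z hz
  exact fun htz => disjoint_left.1 (T.K_disjoint n x hx y hy) ht (h htz)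

/-- The cores of each generation are contained in those of the preceding one. -/
theorem cores_antitone (T : IsNodeTree 𝓕 O root N K) :
    Antitone (fun n => ⋃ x ∈ N n, x.core) := by
  refine antitone_nat_of_succ_le fun n t ht => ?_
  obtain ⟨z, hz, htz⟩ := mem_iUnion₂.1 ht
  obtain ⟨x, hx, h⟩ := T.exists_parent n z hz
  exact mem_iUnion₂.2 ⟨x, hx, h.outer_subset ((T.valid _ z hz).core_subset_outer htz)⟩

theorem exists_descendant (T : IsNodeTree 𝓕 O root N K) {n : ℕ} {x : CurveNode V} (hx : x ∈ N n)
    {U : Set ℝ} (hU : IsOpen U) (hKU : (U ∩ K n x).Nonempty) (j : ℕ) :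
    ∃ z ∈ N (n + (j + 1)), z.outer ⊆ U := by
  have step : ∀ m, ∀ y ∈ N m, (U ∩ K m y).Nonempty → ∃ z ∈ N (m + 1), z.outer ⊆ U := by
    rintro m y hy ⟨t, htU, htK⟩
    obtain ⟨δ, hδ, h⟩ := Metric.isOpen_iff.1 hU t htU
    obtain ⟨z, hz, hzt⟩ := T.accumulates m y hy t htK δ hδ
    exact ⟨z, hz, hzt.trans h⟩
  induction j with
  | zero => exact step n x hx hKU
  | succ j ih =>
    obtain ⟨z, hz, hzU⟩ := ih
    have hne : (K _ z).Nonempty := nonempty_of_measure_ne_zero (T.K_pos _ z hz).ne'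
    obtain ⟨t, ht⟩ := hne
    exact step _ z hz ⟨t, hzU ((T.valid _ z hz).core_subset_outer (T.K_subset _ z hz ht).1), ht⟩

/-- The superposition of all the bumps of a tree. -/
theorem exists_curve [CompleteSpace V] (T : IsNodeTree 𝓕 O root N K) :
    ∃ γ : ℝ → V, NearLinearOn γ root.v (60 * root.ε) univ ∧
      (∀ n, ∀ x ∈ N n, NearLinearOn γ x.v (60 * x.ε) x.core) ∧
      ∀ n, ∀ x ∈ N n, ∀ t ∈ K n x, γ t = x.g t := by
  have hroot : root ∈ N 0 := by rw [T.zero]; rfl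
  have hε0 : 0 < root.ε := (T.valid 0 root hroot).ε_pos
  have hex : ∀ n, ∃ Φ : ℝ → V,
      (∀ s t, ‖Φ s - Φ t‖ ≤ 2 * (14 * (root.ε * (1 / 2) ^ n)) * |s - t|) ∧
      (∀ i ∈ N (n + 1), ∀ t ∈ i.outer, Φ t = i.φ t) ∧
      ∀ t, (∀ i ∈ N (n + 1), t ∉ i.outer) → Φ t = 0 := by
    intro n
    refine exists_superposition (φ := CurveNode.φ) (O := CurveNode.outer) (by positivity)
      (fun z hz => ?_) (fun z hz => ?_) (T.eq_of_mem_outer (n + 1))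
    · obtain ⟨x, hx, h⟩ := T.exists_parent n z hz
      rw [← T.ε_eq n x hx]
      exact h.lip
    · obtain ⟨x, hx, h⟩ := T.exists_parent n z hz
      exact h.eq_zero
  choose Φ hΦ hΦ1 hΦ0 using hex
  have hgeo : Summable fun n : ℕ => root.ε * (1 / 2 : ℝ) ^ n :=
    (summable_geometric_of_lt_one (by norm_num) (by norm_num)).mul_left _
  -- All bumps live in the open core of the root, so they vanish at its endpoint; this base point
  -- turns Lipschitz bounds into summability.
  have hb : ∀ n, Φ n (root.q + root.r) = 0 := by
    intro n
    refine hΦ0 n _ fun z hz hzt => ?_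
    obtain ⟨x, hx, h⟩ := T.exists_parent n z hz
    obtain ⟨y, hy, h'⟩ := T.exists_ancestor 1 n z (by rwa [add_comm])
    obtain ⟨y', hy', h''⟩ := T.exists_parent 0 y hy
    rw [T.zero] at hy'
    rw [show y' = root from hy'] at h''
    have := h''.outer_subset (h' hzt)
    rw [CurveNode.core, Metric.mem_ball, Real.dist_eq, add_sub_cancel_left,
      abs_of_pos (T.valid 0 root hroot).r_pos] at this
    exact this.false
  have hsum : ∀ t, Summable fun n => Φ n t := by
    intro t
    refine Summable.of_norm_bounded (hgeo.mul_left (28 * |t - (root.q + root.r)|)) fun n => ?_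
    have := hΦ n t (root.q + root.r)
    rw [hb n, sub_zero] at this
    exact this.trans_eq (by ring)
  -- The bumps telescope along the chain of ancestors.
  have hpartial : ∀ n, ∀ x ∈ N n, ∀ t ∈ x.core,
      root.g t + ∑ m ∈ Finset.range n, Φ m t = x.g t := by
    intro n
    induction n with
    | zero => intro x hx t _; rw [T.zero] at hx; rw [show x = root from hx]; simp
    | succ n ih =>
      intro z hz t ht
      obtain ⟨x, hx, h⟩ := T.exists_parent n z hz
      have hto := (T.valid _ z hz).core_subset_outer ht
      rw [Finset.sum_range_succ, ← add_assoc, ih x hx t (h.outer_subset hto), hΦ1 n z hz t hto,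
        h.eq_sub t ht]
      abel
  set γ : ℝ → V := fun t => root.g t + ∑' n, Φ n t with hγ
  have hsplit : ∀ n t, γ t = root.g t + ∑ m ∈ Finset.range n, Φ m t + ∑' m, Φ (m + n) t := by
    intro n t
    rw [add_assoc, (hsum t).sum_add_tsum_nat_add n]
  -- The geometric series doubles 28 to 56; adding the node's own `2 * x.ε` stays below `60 * x.ε`.
  have htail : ∀ n s t, ‖(∑' m, Φ (m + n) s) - ∑' m, Φ (m + n) t‖ ≤
      56 * (root.ε * (1 / 2) ^ n) * |s - t| := by
    intro n s t
    rw [← ((summable_nat_add_iff n).2 (hsum s)).tsum_sub ((summable_nat_add_iff n).2 (hsum t))]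
    have hg : HasSum (fun m : ℕ => 28 * (root.ε * (1 / 2) ^ n) * |s - t| * (1 / 2 : ℝ) ^ m)
        (28 * (root.ε * (1 / 2) ^ n) * |s - t| * 2) := hasSum_geometric_two.mul_left _
    refine (tsum_of_norm_bounded hg fun m => ?_).trans_eq (by ring)
    exact (hΦ (m + n) s t).trans_eq (by rw [pow_add]; ring)
  have hnear : ∀ n, ∀ x ∈ N n, ∀ J : Set ℝ,
      (∀ t ∈ J, root.g t + ∑ m ∈ Finset.range n, Φ m t = x.g t) →
      NearLinearOn γ x.v (60 * x.ε) J := by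
    intro n x hx J hJ s hs t ht
    rw [hsplit n s, hsplit n t, hJ s hs, hJ t ht]
    have h1 := (T.valid n x hx).nearLinear s (mem_univ _) t (mem_univ _)
    have h2 := htail n s t
    rw [← T.ε_eq n x hx] at h2
    have e : x.g s + ∑' m, Φ (m + n) s - (x.g t + ∑' m, Φ (m + n) t) - (s - t) • x.v =
      (x.g s - x.g t - (s - t) • x.v) + ((∑' m, Φ (m + n) s) - ∑' m, Φ (m + n) t) := by abel
    rw [e]
    refine (norm_add_le _ _).trans ?_
    have : 0 ≤ x.ε * |s - t| := mul_nonneg (T.valid n x hx).ε_pos.le (abs_nonneg _)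
    linarith
  refine ⟨γ, ?_, fun n x hx => hnear n x hx _ (hpartial n x hx), fun n x hx t ht => ?_⟩
  · exact hnear 0 root hroot univ (by simp)
  · rw [hsplit n t, hpartial n x hx t (T.K_subset n x hx ht).1]
    have : ∀ m, Φ (m + n) t = 0 := fun m =>
      hΦ0 _ t fun z hz => T.notMem_outer_of_mem_K (by omega) hx hz ht
    simp [this]

end IsNodeTree

end Trees

/-! ### The limit curve and its generic parameters -/

section Curve

variable {V : Type*} [NormedAddCommGroup V] [NormedSpace ℝ V]

/-- Every portion of `F` meets `G`. -/
def MeetsEveryPortion (G F : Set ℝ) : Prop :=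
  ∀ U : Set ℝ, IsOpen U → (U ∩ F).Nonempty → (U ∩ F ∩ G).Nonempty

/-- `γ` has an almost constant velocity of norm one near `t`, to any precision. -/
def UnitSpeedNear (γ : ℝ → V) (t : ℝ) : Prop :=
  ∀ ε : ℝ, 0 < ε → ∃ v, ‖v‖ = 1 ∧ ∃ J ∈ 𝓝 t, NearLinearOn γ v ε J

theorem exists_nearLinear_curve [FiniteDimensional ℝ V] {𝓕 W : Set V} {O : ℕ → Set V}
    (h𝓕 : IsClosed 𝓕) (hdir : ∀ U, IsOpen U → (U ∩ 𝓕).Nonempty → ∃ w, IsDirection 𝓕 U w)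
    (hO : ∀ n, IsOpen (O n))
    (hOd : ∀ n U, IsOpen U → (U ∩ 𝓕).Nonempty → (U ∩ O n ∩ 𝓕).Nonempty)
    (hW : IsOpen W) (hW𝓕 : (W ∩ 𝓕).Nonempty) :
    ∃ (γ : ℝ → V) (v : V) (q r : ℝ) (F : Set ℝ) (G : ℕ → Set ℝ), ‖v‖ = 1 ∧ 0 < r ∧ r ≤ 1 / 8 ∧
      NearLinearOn γ v (1 / 10) univ ∧ Metric.closedBall (γ q) (10 * r) ⊆ W ∧
      F ⊆ Metric.closedBall q r ∧ F.Nonempty ∧ IsClosed F ∧ EveryPortionPositiveMeasure F ∧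
      (∀ n, IsOpen (G n)) ∧ (∀ n, MeetsEveryPortion (G n) F) ∧
      (∀ t ∈ ⋂ n, G n, UnitSpeedNear γ t) ∧ ∀ t ∈ ⋂ n, G n, γ t ∈ 𝓕 ∩ ⋂ n, O n := by
  have : CompleteSpace V := FiniteDimensional.complete ℝ V
  obtain ⟨w, hw⟩ := hdir W hW hW𝓕
  -- Precision 2 is free, since unit vectors are at most 2 apart. Refining to `1 / 600` makes the
  -- final error `60 / 600 = 1 / 10`.
  have hd2 : HasDirectionsNear 𝓕 W w 2 := by
    refine ⟨hW, hW𝓕, hw.1, fun U' _ ho hn => ?_⟩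
    obtain ⟨u, hu⟩ := hdir U' ho hn
    refine ⟨u, hu, (norm_sub_le _ _).trans ?_⟩
    rw [hu.1, hw.1]; norm_num
  obtain ⟨U, hUW, v, -, hd⟩ := hd2.refine (show (0 : ℝ) < 1 / 600 by norm_num) Subset.rfl hW hW𝓕
  obtain ⟨g, hg, hgq, hgpos⟩ := hd.exists_curve (by norm_num) 0
  obtain ⟨ρ, hρ, hρW⟩ := Metric.nhds_basis_closedBall.mem_iff.1 (hW.mem_nhds (hUW hgq.1))
  -- `γ 0` is within `4 * r` of `g 0`, so a ball of radius `10 * r` about `γ 0` needs `14 * r ≤ ρ`.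
  set r := min (1 / 8) (ρ / 14) with hr
  have hr0 : 0 < r := lt_min (by norm_num) (by positivity)
  have hr1 : r ≤ 1 / 8 := min_le_left _ _
  have hr2 : r ≤ ρ / 14 := min_le_right _ _
  set root : CurveNode V := ⟨0, 2 * r, r, 1 / 600, v, U, g, 0⟩ with hroot
  have hvalid : root.Valid 𝓕 :=
    ⟨hr0, by simp [hroot], by norm_num [hroot], hg, hd, hgpos r hr0⟩
  obtain ⟨N, K, T⟩ := exists_isNodeTree h𝓕 hO hOd hvalid
  have hmem : root ∈ N 0 := by rw [T.zero]; rfl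
  obtain ⟨γ, hγ, hγN, hγK⟩ := T.exists_curve
  have hγ' : NearLinearOn γ v (1 / 10) univ := by
    have e : (60 * root.ε : ℝ) = 1 / 10 := by norm_num [hroot]
    rwa [e] at hγ
  have hKne : ∀ n, ∀ x ∈ N n, (K n x).Nonempty := fun n x hx =>
    nonempty_of_measure_ne_zero (T.K_pos n x hx).ne'
  have hlip : ∀ s t, ‖γ s - γ t‖ ≤ 2 * |s - t| := by
    intro s t
    have := hγ'.upper hd.norm_eq (mem_univ s) (mem_univ t)
    linarith [abs_nonneg (s - t)]
  have hcore : ∀ n, ∀ x ∈ N n, ∀ t ∈ x.core, ∀ t' ∈ K n x, ‖γ t - γ t'‖ ≤ 4 * x.r := by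
    intro n x hx t ht t' ht'
    have h1 := (T.K_subset n x hx ht').1
    rw [CurveNode.core, Metric.mem_ball, Real.dist_eq] at ht h1
    have := abs_sub_le t x.q t'
    rw [abs_sub_comm x.q t'] at this
    linarith [hlip t t']
  have hcenter : ∀ n, ∀ x ∈ N n, ∀ t ∈ x.core, ‖γ t - x.g x.q‖ ≤ 6 * x.r := by
    intro n x hx t ht
    obtain ⟨t', ht'⟩ := hKne n x hx
    have h1 := (T.K_subset n x hx ht').1
    rw [CurveNode.core, Metric.mem_ball, Real.dist_eq] at h1
    have hv := T.valid n x hx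
    have hε : x.ε ≤ 1 / 600 := by
      rw [T.ε_eq n x hx]
      exact mul_le_of_le_one_right (by norm_num [hroot])
        (pow_le_one₀ (by norm_num) (by norm_num))
    have h2 := hv.nearLinear.upper hv.directions.norm_eq (mem_univ t') (mem_univ x.q)
    have h3 : (1 + 2 * x.ε) * |t' - x.q| ≤ 2 * |t' - x.q| :=
      mul_le_mul_of_nonneg_right (by linarith) (abs_nonneg _)
    have h4 := hcore n x hx t ht t' ht'
    rw [← hγK n x hx t' ht'] at h2
    have h5 := norm_sub_le_norm_sub_add_norm_sub (γ t) (γ t') (x.g x.q)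
    linarith
  set F₀ : Set ℝ := ⋃ n, ⋃ x ∈ N n, K n x with hF₀
  have hF₀root : F₀ ⊆ Metric.closedBall 0 r := by
    intro t ht
    obtain ⟨n, ht⟩ := mem_iUnion.1 ht
    obtain ⟨x, hx, ht⟩ := mem_iUnion₂.1 ht
    have h1 : t ∈ ⋃ x ∈ N n, x.core := mem_iUnion₂.2 ⟨x, hx, (T.K_subset n x hx ht).1⟩
    have h2 := T.cores_antitone (Nat.zero_le n) h1
    simp only [T.zero, mem_singleton_iff, iUnion_iUnion_eq_left] at h2
    exact Metric.ball_subset_closedBall h2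
  -- A portion of the closure contains whole nodes of arbitrarily late generations; positive measure
  -- and density of the cores both follow.
  have hportion : ∀ U : Set ℝ, IsOpen U → (U ∩ closure F₀).Nonempty → ∀ j : ℕ,
      ∃ n ≥ j, ∃ z ∈ N n, z.outer ⊆ U := by
    rintro U hU ⟨t, htU, ht⟩ j
    obtain ⟨s, hsU, hs⟩ := mem_closure_iff.1 ht U hU htU
    obtain ⟨n, hs⟩ := mem_iUnion.1 hs
    obtain ⟨x, hx, hs⟩ := mem_iUnion₂.1 hs
    obtain ⟨z, hz, hzU⟩ := T.exists_descendant hx hU ⟨s, hsU, hs⟩ j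
    exact ⟨_, by omega, z, hz, hzU⟩
  have hKF : ∀ n, ∀ x ∈ N n, K n x ⊆ F₀ := fun n x hx t ht =>
    mem_iUnion.2 ⟨n, mem_iUnion₂.2 ⟨x, hx, ht⟩⟩
  refine ⟨γ, v, 0, r, closure F₀, fun n => ⋃ x ∈ N n, x.core, hd.norm_eq, hr0, hr1, hγ', ?_,
    closure_minimal hF₀root Metric.isClosed_closedBall, ?_, isClosed_closure, ?_, ?_, ?_, ?_, ?_⟩
  · refine (Metric.closedBall_subset_closedBall' ?_).trans hρW
    rw [dist_eq_norm]
    obtain ⟨t', ht'⟩ := hKne 0 root hmem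
    have h1 := hcore 0 root hmem 0 (Metric.mem_ball_self hr0) t' ht'
    have h2 := (T.K_subset 0 root hmem ht').1
    rw [CurveNode.core, Metric.mem_ball, Real.dist_eq] at h2
    have h3 := hcenter 0 root hmem 0 (Metric.mem_ball_self hr0)
    have h4 := hlip 0 t'
    have h5 := hg.upper hd.norm_eq (mem_univ t') (mem_univ 0)
    have h6 : γ t' = g t' := hγK 0 root hmem t' ht'
    have h7 := norm_sub_le_norm_sub_add_norm_sub (γ 0) (γ t') (g 0)
    rw [h6] at h7 h4
    rw [abs_sub_comm] at h4
    change |t' - 0| < r at h2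
    linarith
  · obtain ⟨t, ht⟩ := hKne 0 root hmem
    exact ⟨t, subset_closure (hKF 0 root hmem ht)⟩
  · intro U hU hne
    obtain ⟨n, -, z, hz, hzU⟩ := hportion U hU hne 0
    refine (T.K_pos n z hz).trans_le (measure_mono fun t ht => ⟨hzU ?_, ?_⟩)
    · exact (T.valid n z hz).core_subset_outer (T.K_subset n z hz ht).1
    · exact subset_closure (hKF n z hz ht)
  · exact fun n => isOpen_biUnion fun x _ => Metric.isOpen_ball
  · intro j U hU hne
    obtain ⟨n, hn, z, hz, hzU⟩ := hportion U hU hne j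
    obtain ⟨t, ht⟩ := hKne n z hz
    have htc := (T.K_subset n z hz ht).1
    exact ⟨t, ⟨hzU ((T.valid n z hz).core_subset_outer htc), subset_closure (hKF n z hz ht)⟩,
      T.cores_antitone hn (mem_iUnion₂.2 ⟨z, hz, htc⟩)⟩
  · intro t ht ε hε
    obtain ⟨n, hn⟩ := exists_pow_lt_of_lt_one hε (show (1 / 2 : ℝ) < 1 by norm_num)
    obtain ⟨x, hx, htx⟩ := mem_iUnion₂.1 (mem_iInter.1 ht n)
    refine ⟨x.v, (T.valid n x hx).directions.norm_eq, x.core, Metric.isOpen_ball.mem_nhds htx, ?_⟩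
    refine (hγN n x hx).change (δ := 0) (by simp) ?_
    rw [T.ε_eq n x hx]
    have : root.ε = 1 / 600 := rfl
    rw [this]
    have : (0 : ℝ) < (1 / 2) ^ n := by positivity
    linarith
  · intro t ht
    constructor
    -- Each core around `t` also contains points of its `K`, which `γ` sends into `𝓕`; the radii
    -- tend to zero and `𝓕` is closed.
    · rw [← h𝓕.closure_eq, Metric.mem_closure_iff]
      intro ε hε
      obtain ⟨n, hn⟩ := exists_pow_lt_of_lt_one hε (show (1 / 2 : ℝ) < 1 by norm_num)
      obtain ⟨x, hx, htx⟩ := mem_iUnion₂.1 (mem_iInter.1 ht n)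
      obtain ⟨t', ht'⟩ := hKne n x hx
      refine ⟨γ t', ?_, ?_⟩
      · rw [hγK n x hx t' ht']
        exact (T.K_subset n x hx ht').2.2
      · rw [dist_eq_norm]
        have h1 := T.r_le n x hx
        have h2 : root.r * (1 / 2 : ℝ) ^ n ≤ 1 / 8 * (1 / 2) ^ n := by gcongr
        have : (0 : ℝ) < (1 / 2) ^ n := by positivity
        linarith [hcore n x hx t htx t' ht']
    · refine mem_iInter.2 fun n => ?_
      -- The set `O n` constrains generation `n + 1`.
      obtain ⟨z, hz, htz⟩ := mem_iUnion₂.1 (mem_iInter.1 ht (n + 1))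
      obtain ⟨x, hx, h⟩ := T.exists_parent n z hz
      refine h.ball_subset ?_
      rw [Metric.mem_closedBall, dist_eq_norm]
      exact hcenter (n + 1) z hz t htz

/-! ### Reparametrization -/

/-- The arc length of a Lipschitz curve. -/
theorem exists_arcLength {E : Type*} [NormedAddCommGroup E] {γ : ℝ → E} {L : NNReal} (hγ : LipschitzWith L γ) :
    ∃ σ : ℝ → ℝ, (∀ s t, s ≤ t → ‖γ t - γ s‖ ≤ σ t - σ s) ∧
      ∀ (s t M : ℝ), s ≤ t → (∀ a ∈ Icc s t, ∀ b ∈ Icc s t, ‖γ a - γ b‖ ≤ M * |a - b|) →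
        σ t - σ s ≤ M * (t - s) := by
  have hbv : LocallyBoundedVariationOn γ univ :=
    hγ.lipschitzOnWith.locallyBoundedVariationOn
  have hsub : ∀ s t, s ≤ t → variationOnFromTo γ univ 0 t - variationOnFromTo γ univ 0 s =
      (eVariationOn γ (univ ∩ Icc s t)).toReal := by
    intro s t hst
    rw [← variationOnFromTo.eq_of_le γ univ hst,
      ← variationOnFromTo.add hbv (mem_univ 0) (mem_univ s) (mem_univ t), add_sub_cancel_left]
  refine ⟨fun t => variationOnFromTo γ univ 0 t, fun s t hst => ?_, fun s t M hst hM => ?_⟩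
  · rw [hsub s t hst, ← dist_eq_norm, dist_edist]
    refine ENNReal.toReal_mono (hbv s t (mem_univ _) (mem_univ _)) ?_
    exact eVariationOn.edist_le γ ⟨mem_univ _, right_mem_Icc.2 hst⟩ ⟨mem_univ _, left_mem_Icc.2 hst⟩
  · rw [hsub s t hst, univ_inter]
    rcases hst.eq_or_lt with rfl | hlt
    · simp [eVariationOn.subsingleton]
    have hM0 : 0 ≤ M := by
      have := (norm_nonneg _).trans (hM t (right_mem_Icc.2 hst) s (left_mem_Icc.2 hst))
      exact nonneg_of_mul_nonneg_left this (abs_pos.2 (sub_ne_zero.2 hlt.ne'))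
    have hlip : LipschitzOnWith (Real.toNNReal M) γ (Icc s t) := by
      refine LipschitzOnWith.of_dist_le_mul fun a ha b hb => ?_
      rw [dist_eq_norm, Real.dist_eq, Real.coe_toNNReal _ hM0]
      exact hM a ha b hb
    have h1 := hlip.comp_eVariationOn_le (g := id) (s := Icc s t) (mapsTo_id _)
    have h2 : eVariationOn (id : ℝ → ℝ) (Icc s t) ≤ ENNReal.ofReal (t - s) := by
      have := (monotone_id (α := ℝ)).monotoneOn (Icc s t) |>.eVariationOn_eq
        (left_mem_Icc.2 hst) (right_mem_Icc.2 hst)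
      rw [inter_self] at this
      exact this.le
    have h3 : eVariationOn γ (Icc s t) ≤ ENNReal.ofReal (M * (t - s)) := by
      rw [ENNReal.ofReal_mul hM0]
      refine h1.trans ?_
      rw [← ENNReal.ofReal]
      gcongr
    exact ENNReal.toReal_le_of_le_ofReal (mul_nonneg hM0 (by linarith)) h3

theorem exists_homeomorph_of_biLipschitz {f : ℝ → ℝ} {a b : ℝ} (ha : 0 < a)
    (hl : ∀ s t, s ≤ t → a * (t - s) ≤ f t - f s) (hu : ∀ s t, s ≤ t → f t - f s ≤ b * (t - s)) :
    ∃ e : ℝ ≃ₜ ℝ, ∀ t, e t = f t := by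
  have hmono : StrictMono f := by
    intro s t hst
    have := hl s t hst.le
    nlinarith
  have hb : 0 ≤ b := by
    have h1 := hl 0 1 zero_le_one
    have h2 := hu 0 1 zero_le_one
    linarith
  have hcont : Continuous f := by
    have : LipschitzWith (Real.toNNReal b) f := by
      refine LipschitzWith.of_dist_le_mul fun s t => ?_
      rw [Real.coe_toNNReal _ hb, Real.dist_eq, Real.dist_eq]
      rcases le_total s t with h | h
      · rw [abs_sub_comm, abs_sub_comm s, abs_of_nonneg (sub_nonneg.2 h),
          abs_of_nonneg (sub_nonneg.2 (hmono.monotone h))]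
        exact hu s t h
      · rw [abs_of_nonneg (sub_nonneg.2 h), abs_of_nonneg (sub_nonneg.2 (hmono.monotone h))]
        exact hu t s h
    exact this.continuous
  have htop : Tendsto f atTop atTop := by
    refine tendsto_atTop_mono' atTop (f₁ := fun t => f 0 + a * t) ?_ ?_
    · filter_upwards [eventually_ge_atTop 0] with t ht
      have := hl 0 t ht
      linarith
    · exact tendsto_atTop_add_const_left _ _ (tendsto_id.const_mul_atTop ha)
  have hbot : Tendsto f atBot atBot := by
    refine tendsto_atBot_mono' atBot (f₁ := fun t => f 0 + a * t) ?_ ?_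
    · filter_upwards [eventually_le_atBot 0] with t ht
      have := hl t 0 ht
      linarith
    · exact tendsto_atBot_add_const_left _ _ (tendsto_id.const_mul_atBot ha)
  have hsurj := hcont.surjective htop hbot
  exact ⟨(hmono.orderIsoOfSurjective f hsurj).toHomeomorph, fun t => rfl⟩

/-- A time change of `ℝ` that is the identity on `[-ρ, ρ]` and has slope `c` elsewhere. -/
theorem exists_slowdown {c ρ : ℝ} (hc0 : 0 < c) (hc1 : c ≤ 1) (hρ : 0 < ρ) :
    ∃ κ : ℝ → ℝ, (∀ s t, s ≤ t → c * (t - s) ≤ κ t - κ s) ∧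
      (∀ s t, s ≤ t → κ t - κ s ≤ 1 * (t - s)) ∧ (∀ t, |t| ≤ ρ → κ t = t) ∧
      ∀ t, |κ t| ≤ c * |t| + ρ := by
  set m : ℝ → ℝ := fun t => max (-ρ) (min ρ t) with hm
  have hmono : ∀ s t, s ≤ t → m s ≤ m t := fun s t h =>
    max_le_max le_rfl (min_le_min le_rfl h)
  have hlip : ∀ s t, s ≤ t → m t - m s ≤ t - s := by
    intro s t h
    have h1 := abs_max_sub_max_le_max (-ρ) (min ρ t) (-ρ) (min ρ s)
    have h2 := abs_min_sub_min_le_max ρ t ρ s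
    simp only [sub_self, abs_zero, abs_nonneg, sup_of_le_right] at h1 h2
    rw [abs_of_nonneg (sub_nonneg.2 h)] at h2
    exact (le_abs_self _).trans (h1.trans h2)
  have hmρ : ∀ t, |m t| ≤ ρ := fun t =>
    abs_le.2 ⟨le_max_left _ _, max_le (by linarith) (min_le_left _ _)⟩
  refine ⟨fun t => c * t + (1 - c) * m t, fun s t h => ?_, fun s t h => ?_, fun t h => ?_,
    fun t => ?_⟩
  · have := mul_nonneg (sub_nonneg.2 hc1) (sub_nonneg.2 (hmono s t h))
    linarith
  · have := mul_le_mul_of_nonneg_left (hlip s t h) (sub_nonneg.2 hc1)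
    linarith
  · obtain ⟨h1, h2⟩ := abs_le.1 h
    simp only [hm]
    rw [min_eq_right h2, max_eq_right h1]
    ring
  · refine (abs_add_le _ _).trans ?_
    rw [abs_mul, abs_mul, abs_of_pos hc0, abs_of_nonneg (sub_nonneg.2 hc1)]
    have := mul_le_mul_of_nonneg_left (hmρ t) (sub_nonneg.2 hc1)
    nlinarith

/-- Lipschitz maps send null sets to null sets; the Hausdorff measure version needs no measurability
of `S`. -/
theorem LipschitzWith.volume_pos_of_volume_image_pos {L : NNReal} {f : ℝ → ℝ}
    (hf : LipschitzWith L f) {S : Set ℝ} (h : 0 < volume (f '' S)) : 0 < volume S := by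
  by_contra h0
  have h1 := hf.hausdorffMeasure_image_le zero_le_one S
  rw [hausdorffMeasure_real, le_antisymm (not_lt.1 h0) bot_le] at h1
  simp only [mul_zero] at h1
  exact h.not_ge h1

theorem EveryPortionPositiveMeasure.preimage {F : Set ℝ} (hF : EveryPortionPositiveMeasure F)
    (θ : ℝ ≃ₜ ℝ) {L : NNReal} (hθ : LipschitzWith L θ) :
    EveryPortionPositiveMeasure (θ ⁻¹' F) := by
  intro U hU hne
  refine hθ.volume_pos_of_volume_image_pos ?_
  rw [image_inter_preimage]
  refine hF _ (θ.isOpenMap U hU) ?_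
  rw [← image_inter_preimage]
  exact hne.image θ

theorem MeetsEveryPortion.preimage {G F : Set ℝ} (h : MeetsEveryPortion G F) (θ : ℝ ≃ₜ ℝ) :
    MeetsEveryPortion (θ ⁻¹' G) (θ ⁻¹' F) := by
  rintro U hU ⟨t, ht, htF⟩
  obtain ⟨_, ⟨⟨s, hs, rfl⟩, hsF⟩, hsG⟩ := h _ (θ.isOpenMap U hU) ⟨θ t, mem_image_of_mem _ ht, htF⟩
  exact ⟨s, ⟨hs, hsF⟩, hsG⟩

/-- A nearly linear curve can be reparametrized so as to have unit speed near `q`, and small but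
non-vanishing speed farther away. -/
theorem exists_reparametrization {γ : ℝ → V} {v : V} {q r : ℝ} (hv : ‖v‖ = 1) (hr : 0 < r)
    (hr1 : r ≤ 1 / 8) (hγ : NearLinearOn γ v (1 / 10) univ) :
    ∃ (θ : ℝ ≃ₜ ℝ) (L : NNReal) (c : ℝ), 0 < c ∧ LipschitzWith L θ ∧
      (∀ s t, ‖γ (θ s) - γ (θ t)‖ ≤ |s - t|) ∧ (∀ s t, c * |s - t| ≤ ‖γ (θ s) - γ (θ t)‖) ∧
      (∀ t ∈ Icc (0 : ℝ) 1, γ (θ t) ∈ Metric.closedBall (γ q) (10 * r)) ∧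
      θ ⁻¹' (Metric.closedBall q r) ⊆ Ioo 0 1 ∧
      ∀ t ∈ θ ⁻¹' (Metric.closedBall q r), UnitSpeedNear γ (θ t) → UnitSpeedNear (γ ∘ θ) t := by
  have hup : ∀ s t, ‖γ s - γ t‖ ≤ 11 / 10 * |s - t| := fun s t =>
    (hγ.upper hv (mem_univ s) (mem_univ t)).trans_eq (by norm_num)
  have hlow : ∀ s t, 9 / 10 * |s - t| ≤ ‖γ s - γ t‖ := fun s t =>
    le_trans (by norm_num) (hγ.lower hv (mem_univ s) (mem_univ t))
  have hlip : LipschitzWith (11 / 10) γ := LipschitzWith.of_dist_le_mul fun s t => by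
    rw [dist_eq_norm, Real.dist_eq]
    exact (hup s t).trans_eq (by push_cast; rfl)
  obtain ⟨σ, hσ1, hσ2⟩ := exists_arcLength hlip
  have hσl : ∀ s t, s ≤ t → 9 / 10 * (t - s) ≤ σ t - σ s := fun s t h => by
    have h1 := hlow t s
    rw [abs_of_nonneg (sub_nonneg.2 h)] at h1
    exact h1.trans (hσ1 s t h)
  have hσu : ∀ s t, s ≤ t → σ t - σ s ≤ 11 / 10 * (t - s) := fun s t h =>
    hσ2 s t _ h fun a _ b _ => hup a b
  obtain ⟨e, he⟩ := exists_homeomorph_of_biLipschitz (by norm_num) hσl hσu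
  -- Slope `r` outside `[-2 * r, 2 * r]` keeps the arc length from the centre below `3 * r` on `[0,
  -- 1]`. Parameters over the ball about `q` have arc length at most `11 / 10 * r` from it, hence
  -- lie where `κ` is the identity.
  obtain ⟨κ, hκl, hκu, hκ1, hκb⟩ := exists_slowdown hr (by linarith) (show 0 < 2 * r by linarith)
  obtain ⟨k, hk⟩ := exists_homeomorph_of_biLipschitz hr hκl hκu
  set θ : ℝ ≃ₜ ℝ := ((Homeomorph.addRight (-(1 / 2) : ℝ)).trans k).trans
    ((Homeomorph.addRight (σ q)).trans e.symm) with hθ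
  have hσθ : ∀ t, σ (θ t) = κ (t - 1 / 2) + σ q := by
    intro t
    rw [← he]
    simp [hθ, hk, sub_eq_add_neg]
  have hκabs : ∀ s t, |κ s - κ t| ≤ |s - t| ∧ r * |s - t| ≤ |κ s - κ t| := by
    have : ∀ s t, s ≤ t → |κ s - κ t| ≤ |s - t| ∧ r * |s - t| ≤ |κ s - κ t| := by
      intro s t h
      have h1 := hκl s t h
      have h2 := hκu s t h
      have h3 := mul_nonneg hr.le (sub_nonneg.2 h)
      rw [abs_sub_comm, abs_sub_comm s, abs_of_nonneg (sub_nonneg.2 h), abs_of_nonneg (by linarith)]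
      exact ⟨by linarith, h1⟩
    intro s t
    rcases le_total s t with h | h
    · exact this s t h
    · rw [abs_sub_comm, abs_sub_comm s]; exact this t s h
  have hσabs : ∀ s t, ‖γ s - γ t‖ ≤ |σ s - σ t| ∧ 9 / 10 * |s - t| ≤ |σ s - σ t| ∧
      |σ s - σ t| ≤ 11 / 10 * |s - t| := by
    have : ∀ s t, s ≤ t → ‖γ s - γ t‖ ≤ |σ s - σ t| ∧ 9 / 10 * |s - t| ≤ |σ s - σ t| ∧
        |σ s - σ t| ≤ 11 / 10 * |s - t| := by
      intro s t h
      have h1 := hσl s t h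
      have h2 := hσu s t h
      have h3 := hσ1 s t h
      rw [abs_sub_comm, abs_sub_comm s, norm_sub_rev, abs_of_nonneg (sub_nonneg.2 h),
        abs_of_nonneg ((norm_nonneg _).trans h3)]
      exact ⟨h3, h1, h2⟩
    intro s t
    rcases le_total s t with h | h
    · exact this s t h
    · rw [abs_sub_comm, abs_sub_comm s, norm_sub_rev]; exact this t s h
  have hσθabs : ∀ s t, |σ (θ s) - σ (θ t)| ≤ |s - t| ∧ r * |s - t| ≤ |σ (θ s) - σ (θ t)| := by
    intro s t
    have := hκabs (s - 1 / 2) (t - 1 / 2)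
    rw [hσθ, hσθ]
    simpa using this
  have hloc : ∀ t, |κ (t - 1 / 2)| < 2 * r → |t - 1 / 2| < 2 * r := by
    intro t ht
    by_contra! h
    rcases le_abs'.1 h with h | h
    · have := hκl _ _ h
      rw [hκ1 (-(2 * r)) (by rw [abs_neg, abs_of_pos (by linarith)])] at this
      have h' := mul_nonneg hr.le (sub_nonneg.2 h)
      linarith [(abs_lt.1 ht).1]
    · have := hκl _ _ h
      rw [hκ1 (2 * r) (by rw [abs_of_pos (by linarith)])] at this
      have h' := mul_nonneg hr.le (sub_nonneg.2 h)
      linarith [(abs_lt.1 ht).2]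
  have hball : ∀ t ∈ θ ⁻¹' (Metric.closedBall q r), |t - 1 / 2| < 2 * r := by
    intro t ht
    rw [mem_preimage, Metric.mem_closedBall, Real.dist_eq] at ht
    refine hloc t ?_
    have h1 := (hσabs (θ t) q).2.2
    rw [hσθ, add_sub_cancel_right] at h1
    linarith
  refine ⟨θ, 10 / 9, 9 / 11 * r, by positivity, ?_, fun s t => ?_, fun s t => ?_, fun t ht => ?_,
    fun t ht => ?_, fun t ht hu => ?_⟩
  · refine LipschitzWith.of_dist_le_mul fun s t => ?_
    rw [Real.dist_eq, Real.dist_eq]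
    have h1 := (hσabs (θ s) (θ t)).2.1
    have h2 := (hσθabs s t).1
    push_cast
    linarith
  · exact (hσabs _ _).1.trans (hσθabs s t).1
  · have h1 := (hσabs (θ s) (θ t)).2.2
    have h2 := (hσθabs s t).2
    have h3 := hlow (θ s) (θ t)
    linarith
  · rw [Metric.mem_closedBall, dist_eq_norm]
    refine (hσabs _ _).1.trans ?_
    rw [hσθ, add_sub_cancel_right]
    refine (hκb _).trans ?_
    have : |t - 1 / 2| ≤ 1 := abs_le.2 ⟨by linarith [ht.1], by linarith [ht.2]⟩
    have := mul_le_mul_of_nonneg_left this hr.le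
    linarith
  · have := abs_lt.1 (hball t ht)
    exact ⟨by linarith [this.1], by linarith [this.2]⟩
  · intro ε hε
    obtain ⟨w, hw, J, hJ, hnear⟩ := hu (ε / 3) (by positivity)
    obtain ⟨ρ, hρ, hρJ⟩ := Metric.mem_nhds_iff.1 hJ
    refine ⟨w, hw, θ ⁻¹' (Metric.ball (θ t) ρ) ∩ Metric.ball (1 / 2) (2 * r), ?_, ?_⟩
    · refine inter_mem (θ.continuous.continuousAt.preimage_mem_nhds (Metric.ball_mem_nhds _ hρ)) ?_
      refine Metric.isOpen_ball.mem_nhds ?_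
      rw [Metric.mem_ball, Real.dist_eq]
      exact hball t ht
    · have hnear' := hnear.mono hρJ
      -- Arc length is squeezed between the chord and the local Lipschitz bound, so near `θ t` it
      -- almost equals the old parameter.
      have harc : ∀ a ∈ Metric.ball (θ t) ρ, ∀ b ∈ Metric.ball (θ t) ρ,
          |(a - b) - (σ a - σ b)| ≤ ε / 3 * |a - b| := by
        have key : ∀ a ∈ Metric.ball (θ t) ρ, ∀ b ∈ Metric.ball (θ t) ρ, a ≤ b →
            |(a - b) - (σ a - σ b)| ≤ ε / 3 * |a - b| := by
          intro a ha b hb hab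
          have hI : Icc a b ⊆ Metric.ball (θ t) ρ := by
            rw [Real.ball_eq_Ioo] at ha hb ⊢
            exact fun x hx => ⟨ha.1.trans_le hx.1, hx.2.trans_lt hb.2⟩
          have h1 := hσ2 a b _ hab fun x hx y hy => hnear'.upper hw (hI hx) (hI hy)
          have h2 := hσ1 a b hab
          have h3 := hnear'.lower hw hb ha
          rw [abs_sub_comm a b, abs_of_nonneg (sub_nonneg.2 hab)] at *
          rw [abs_le]
          constructor <;> linarith
        intro a ha b hb
        rcases le_total a b with h | h
        · exact key a ha b hb h
        · have := key b hb a ha h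
          rw [abs_sub_comm b a] at this
          convert this using 1
          rw [← abs_neg]; ring_nf
      rintro a ⟨ha, ha2⟩ b ⟨hb, hb2⟩
      rw [Metric.mem_ball, Real.dist_eq] at ha2 hb2
      have hab : σ (θ a) - σ (θ b) = a - b := by
        rw [hσθ, hσθ, hκ1 _ ha2.le, hκ1 _ hb2.le]; ring
      have h1 := hnear' _ ha _ hb
      have h2 := harc _ ha _ hb
      rw [hab] at h2
      have h3 := (hσabs (θ a) (θ b)).2.1
      rw [hab] at h3
      have h4 : ‖((θ a - θ b) - (a - b)) • w‖ ≤ ε / 3 * |θ a - θ b| := by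
        rwa [norm_smul, hw, mul_one, Real.norm_eq_abs]
      have e1 : (γ ∘ θ) a - (γ ∘ θ) b - (a - b) • w =
          (γ (θ a) - γ (θ b) - (θ a - θ b) • w) + ((θ a - θ b) - (a - b)) • w := by
        simp only [Function.comp, sub_smul]; abel
      rw [e1]
      refine (norm_add_le _ _).trans ?_
      have h5 : ε * (9 / 10 * |θ a - θ b|) ≤ ε * |a - b| := by gcongr
      have h6 : 0 ≤ ε * |θ a - θ b| := by positivity
      linarith

/-! ### Derivatives -/

/-- Approximate velocities at two precisions compete on a common neighbourhood, so they differ by at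
most the sum of the errors. They form a Cauchy sequence, whose limit is the derivative. -/
theorem UnitSpeedNear.exists_hasDerivAt [CompleteSpace V] {γ : ℝ → V} {t : ℝ}
    (h : UnitSpeedNear γ t) : ∃ v, ‖v‖ = 1 ∧ HasDerivAt γ v t := by
  have hpos : ∀ n : ℕ, (0 : ℝ) < 1 / (n + 1) := fun n => Nat.one_div_pos_of_nat
  choose v hv J hJ hnear using fun n : ℕ => h (1 / (n + 1)) (hpos n)
  have hclose : ∀ n m, ‖v n - v m‖ ≤ 1 / (n + 1) + 1 / (m + 1) := by
    intro n m
    obtain ⟨δ, hδ, hδJ⟩ := Metric.mem_nhds_iff.1 (inter_mem (hJ n) (hJ m))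
    have hs : t + δ / 2 ∈ Metric.ball t δ := by
      rw [Metric.mem_ball, Real.dist_eq, add_sub_cancel_left, abs_of_pos (by positivity)]
      linarith
    have ht : t ∈ Metric.ball t δ := Metric.mem_ball_self hδ
    have h1 := hnear n _ (hδJ hs).1 _ (hδJ ht).1
    have h2 := hnear m _ (hδJ hs).2 _ (hδJ ht).2
    rw [add_sub_cancel_left, abs_of_pos (show 0 < δ / 2 by positivity)] at h1 h2
    have e : (δ / 2) • (v n - v m) = (γ (t + δ / 2) - γ t - (δ / 2) • v m) -
        (γ (t + δ / 2) - γ t - (δ / 2) • v n) := by rw [smul_sub]; abel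
    have h3 := norm_sub_le (γ (t + δ / 2) - γ t - (δ / 2) • v m)
      (γ (t + δ / 2) - γ t - (δ / 2) • v n)
    rw [← e, norm_smul, Real.norm_eq_abs, abs_of_pos (show 0 < δ / 2 by positivity)] at h3
    have h4 : δ / 2 * ‖v n - v m‖ ≤ δ / 2 * (1 / (n + 1) + 1 / (m + 1)) := by linarith
    exact le_of_mul_le_mul_left h4 (by positivity)
  have hlim0 : Tendsto (fun n : ℕ => (1 / (n + 1) : ℝ) + 1 / (n + 1)) atTop (𝓝 0) := by
    simpa using tendsto_one_div_add_atTop_nhds_zero_nat.add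
      (tendsto_one_div_add_atTop_nhds_zero_nat (𝕜 := ℝ))
  have hcauchy : CauchySeq v := by
    refine cauchySeq_of_le_tendsto_0 _ (fun n m N hn hm => ?_) hlim0
    rw [dist_eq_norm]
    refine (hclose n m).trans (add_le_add ?_ ?_)
    · exact Nat.one_div_le_one_div hn
    · exact Nat.one_div_le_one_div hm
  obtain ⟨u, hu⟩ := cauchySeq_tendsto_of_complete hcauchy
  have hun : ∀ n : ℕ, ‖v n - u‖ ≤ 1 / (n + 1) := by
    intro n
    have h1 : Tendsto (fun m => ‖v n - v m‖) atTop (𝓝 ‖v n - u‖) :=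
      (tendsto_const_nhds.sub hu).norm
    have h2 : Tendsto (fun m : ℕ => (1 / (n + 1) : ℝ) + 1 / (m + 1)) atTop
        (𝓝 (1 / (n + 1) + 0)) := tendsto_const_nhds.add tendsto_one_div_add_atTop_nhds_zero_nat
    rw [add_zero] at h2
    exact le_of_tendsto_of_tendsto' h1 h2 (hclose n)
  refine ⟨u, tendsto_nhds_unique hu.norm (by simp [hv]), ?_⟩
  rw [hasDerivAt_iff_isLittleO, Asymptotics.isLittleO_iff]
  intro c hc
  obtain ⟨n, hn⟩ := exists_nat_one_div_lt (show 0 < c / 2 by positivity)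
  filter_upwards [hJ n] with s hs
  exact ((hnear n).change (hun n) (show _ ≤ c by linarith)) s hs t (mem_of_mem_nhds (hJ n))

theorem NearLinearOn.norm_deriv_sub_le {γ : ℝ → V} {v : V} {ε t : ℝ} {J : Set ℝ}
    (h : NearLinearOn γ v ε J) (hε : 0 ≤ ε) (hJ : J ∈ 𝓝 t) (hd : DifferentiableAt ℝ γ t) :
    ‖deriv γ t - v‖ ≤ ε := by
  have h1 : HasDerivAt (fun s => γ s - s • v) (deriv γ t - v) t := by
    have := hd.hasDerivAt.sub ((hasDerivAt_id t).smul_const v)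
    rw [one_smul] at this
    exact this
  refine h1.le_of_lip' hε ?_
  filter_upwards [hJ] with s hs
  have := h s hs t (mem_of_mem_nhds hJ)
  have e : γ s - s • v - (γ t - t • v) = γ s - γ t - (s - t) • v := by rw [sub_smul]; abel
  rw [e]
  exact this

theorem le_norm_deriv_of_antilipschitz {γ : ℝ → V} {c t : ℝ}
    (h : ∀ s t, c * |s - t| ≤ ‖γ s - γ t‖) (hd : DifferentiableAt ℝ γ t) : c ≤ ‖deriv γ t‖ := by
  refine ge_of_tendsto (hasDerivAt_iff_tendsto_slope.1 hd.hasDerivAt).norm ?_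
  filter_upwards [self_mem_nhdsWithin] with s hs
  have hs' : 0 < |s - t| := abs_pos.2 (sub_ne_zero.2 hs)
  rw [slope_def_module, norm_smul, norm_inv, Real.norm_eq_abs, inv_mul_eq_div, le_div_iff₀ hs']
  exact h s t

end Curve

/-! ### Category arguments and assembly -/

theorem isResidualIn_inter_iInter {F : Set ℝ} {G : ℕ → Set ℝ} (hG : ∀ n, IsOpen (G n))
    (hGF : ∀ n, MeetsEveryPortion (G n) F) : IsResidualIn (F ∩ ⋂ n, G n) F := by
  have : ((↑) ⁻¹' (F ∩ ⋂ n, G n) : Set F) = ⋂ n, ((↑) ⁻¹' G n : Set F) := by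
    ext x; simp
  rw [IsResidualIn, this]
  refine countable_iInter_mem.2 fun n => ?_
  refine residual_of_dense_open ((hG n).preimage continuous_subtype_val) ?_
  refine dense_iff_inter_open.2 ?_
  rintro _ ⟨U, hU, rfl⟩ ⟨x, hx⟩
  obtain ⟨y, ⟨hyU, hyF⟩, hyG⟩ := hGF n U hU ⟨x, hx, x.2⟩
  exact ⟨⟨y, hyF⟩, hyU, hyG⟩

/-- A residual set contains a dense Gδ of the complete space `F`; its open factors are lifted to
`X`. The last clause serves to find a point of `𝓕` in the open cube. -/
theorem IsResidualIn.exists_open {X : Type*} [MetricSpace X] [CompleteSpace X] {S F : Set X}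
    (hF : IsClosed F) (h : IsResidualIn S F) : ∃ O : ℕ → Set X, (∀ n, IsOpen (O n)) ∧
      (∀ n U, IsOpen U → (U ∩ F).Nonempty → (U ∩ O n ∩ F).Nonempty) ∧
      F ∩ (⋂ n, O n) ⊆ S ∧ ∀ U, IsOpen U → (U ∩ F).Nonempty → (U ∩ F ∩ S).Nonempty := by
  have : CompleteSpace F := hF.completeSpace_coe
  obtain ⟨t, htS, htG, htd⟩ := mem_residual.1 h
  obtain ⟨f, hf, rfl⟩ := htG.eq_iInter_nat
  choose O hO hOf using fun n => isOpen_induced_iff.1 (hf n)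
  have hd : ∀ U, IsOpen U → (U ∩ F).Nonempty → ∃ x : F, (x : X) ∈ U ∧ x ∈ ⋂ n, f n := by
    rintro U hU ⟨x, hxU, hxF⟩
    obtain ⟨y, hy, hyt⟩ := htd.inter_open_nonempty _ (hU.preimage continuous_subtype_val)
      ⟨⟨x, hxF⟩, hxU⟩
    exact ⟨y, hy, hyt⟩
  refine ⟨O, hO, fun n U hU hne => ?_, ?_, fun U hU hne => ?_⟩
  · obtain ⟨x, hxU, hx⟩ := hd U hU hne
    have := mem_iInter.1 hx n
    rw [← hOf n] at this
    exact ⟨x, ⟨hxU, this⟩, x.2⟩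
  · rintro x ⟨hxF, hx⟩
    refine htS (a := ⟨x, hxF⟩) (mem_iInter.2 fun n => ?_)
    rw [← hOf n]
    exact mem_iInter.1 hx n
  · obtain ⟨x, hxU, hx⟩ := hd U hU hne
    exact ⟨x, ⟨hxU, x.2⟩, htS hx⟩

theorem isOpen_openUnitCube (d : ℕ) : IsOpen (openUnitCube d) := by
  have : openUnitCube d = ⋂ i, (fun x : EuclideanSpace ℝ (Fin d) => x i) ⁻¹' Ioo 0 1 := by
    ext x; simp [openUnitCube]
  rw [this]
  exact isOpen_iInter_of_finite fun i => isOpen_Ioo.preimage (by fun_prop)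

theorem derivWithin_Icc_eq_deriv {d : ℕ} {γ : ℝ → EuclideanSpace ℝ (Fin d)} {t : ℝ}
    (ht : t ∈ Ioo (0 : ℝ) 1) : derivWithin γ (Icc 0 1) t = deriv γ t :=
  derivWithin_of_mem_nhds (Icc_mem_nhds ht.1 ht.2)

/-- Lipschitz maps are differentiable almost everywhere, and near `t` all existing derivatives are
close to a single vector. -/
theorem UnitSpeedNear.tendsto_essOsc {d : ℕ} {γ : ℝ → EuclideanSpace ℝ (Fin d)} {L : NNReal}
    (hγ : LipschitzWith L γ) {t : ℝ} (ht : t ∈ Ioo (0 : ℝ) 1) (h : UnitSpeedNear γ t) :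
    Tendsto (fun δ : ℝ => essOsc (derivWithin γ (Icc 0 1)) (Icc (t - δ) (t + δ) ∩ Icc 0 1))
      (𝓝[>] 0) (𝓝 0) := by
  rw [ENNReal.tendsto_nhds_zero]
  intro ε hε
  obtain ⟨η, hη, hηε⟩ := ENNReal.lt_iff_exists_nnreal_btwn.1 hε
  have hη0 : (0 : ℝ) < η := by exact_mod_cast hη
  obtain ⟨v, hv, J, hJ, hnear⟩ := h (η / 2) (by positivity)
  obtain ⟨ρ, hρ, hρJ⟩ := Metric.mem_nhds_iff.1 (inter_mem hJ (Ioo_mem_nhds ht.1 ht.2))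
  filter_upwards [Ioo_mem_nhdsGT hρ] with δ hδ
  refine le_trans ?_ hηε.le
  have hae : ∀ᵐ s ∂(volume.restrict (Icc (t - δ) (t + δ) ∩ Icc 0 1)),
      ‖derivWithin γ (Icc 0 1) s - v‖ ≤ η / 2 := by
    rw [ae_restrict_iff' (measurableSet_Icc.inter measurableSet_Icc)]
    filter_upwards [hγ.ae_differentiableAt_real] with s hs hsI
    have hsb : s ∈ Metric.ball t ρ := by
      rw [Real.ball_eq_Ioo]
      exact ⟨by linarith [hsI.1.1, hδ.2], by linarith [hsI.1.2, hδ.2]⟩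
    rw [derivWithin_Icc_eq_deriv (hρJ hsb).2]
    exact hnear.norm_deriv_sub_le (by positivity)
      (mem_of_superset (Metric.isOpen_ball.mem_nhds hsb) fun x hx => (hρJ hx).1) hs
  refine essSup_le_of_ae_le _ ?_
  filter_upwards [Measure.quasiMeasurePreserving_fst.ae hae,
    Measure.quasiMeasurePreserving_snd.ae hae] with p h1 h2
  have : ‖derivWithin γ (Icc 0 1) p.1 - derivWithin γ (Icc 0 1) p.2‖ ≤ η := by
    have := norm_sub_le_norm_sub_add_norm_sub (derivWithin γ (Icc 0 1) p.1) v
      (derivWithin γ (Icc 0 1) p.2)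
    rw [norm_sub_rev v] at this
    linarith
  rw [← ofReal_norm]
  exact ENNReal.ofReal_le_of_le_toReal (by simpa using this)

theorem theorem2p8 (d : ℕ) (hd : 1 ≤ d)
    (𝓕 : Set (EuclideanSpace ℝ (Fin d)))
    (h𝓕cube : 𝓕 ⊆ closedUnitCube d) (h𝓕ne : 𝓕.Nonempty) (h𝓕cl : IsClosed 𝓕)
    (h𝓕cw : EveryPortionPositiveConeWidth 𝓕)
    (𝓐 : Set (EuclideanSpace ℝ (Fin d)))
    (h𝓐cube : 𝓐 ⊆ openUnitCube d) (h𝓐an : AnalyticSet 𝓐)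
    (h𝓐res : IsResidualIn (𝓐 ∩ 𝓕) 𝓕) :
    ∃ (γ : ℝ → EuclideanSpace ℝ (Fin d)) (E F : Set ℝ),
      IsOneLipschitzCurve γ ∧
      (∀ t ∈ Icc (0 : ℝ) 1, γ t ∈ openUnitCube d) ∧
      E ⊆ F ∧ F ⊆ Icc 0 1 ∧
      F.Nonempty ∧ IsClosed F ∧ EveryPortionPositiveMeasure F ∧
      IsResidualIn E F ∧
      (∀ t ∈ E, DifferentiableWithinAt ℝ γ (Icc 0 1) t ∧ ‖derivWithin γ (Icc 0 1) t‖ = 1) ∧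
      (∀ t ∈ E, Tendsto
        (fun δ : ℝ => essOsc (derivWithin γ (Icc 0 1)) (Icc (t - δ) (t + δ) ∩ Icc 0 1))
        (𝓝[>] 0) (𝓝 0)) ∧
      γ '' E ⊆ 𝓐 := by
  obtain ⟨O, hO, hOd, hO𝓐, hdense⟩ := h𝓐res.exists_open h𝓕cl
  have hdir : ∀ U, IsOpen U → (U ∩ 𝓕).Nonempty → ∃ w, IsDirection 𝓕 U w := by
    intro U hU hne
    obtain ⟨ν, hν, hpos⟩ := h𝓕cw U hU hne
    exact exists_isDirection hν hpos
  have hW : (openUnitCube d ∩ 𝓕).Nonempty := by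
    obtain ⟨x, ⟨-, hx⟩, hx𝓐, -⟩ := hdense univ isOpen_univ (by simpa using h𝓕ne)
    exact ⟨x, h𝓐cube hx𝓐, hx⟩
  obtain ⟨γ, v, q, r, F, G, hv, hr, hr1, hγ, hcube, hFq, hFne, hFcl, hFpos, hG, hGF, hspeed, hγO⟩ :=
    exists_nearLinear_curve h𝓕cl hdir hO hOd (isOpen_openUnitCube d) hW
  obtain ⟨θ, L, c, hc, hθL, hup, hlow, hball, hθq, hθu⟩ :=
    exists_reparametrization (q := q) hv hr hr1 hγ
  have hlip : LipschitzWith 1 (γ ∘ θ) := LipschitzWith.of_dist_le_mul fun s t => by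
    rw [dist_eq_norm, Real.dist_eq, NNReal.coe_one, one_mul]
    exact hup s t
  have hFI : θ ⁻¹' F ⊆ Ioo 0 1 := (preimage_mono hFq).trans hθq
  have hE : ∀ t ∈ θ ⁻¹' F ∩ ⋂ n, θ ⁻¹' G n, UnitSpeedNear (γ ∘ θ) t := fun t ht =>
    hθu t (hFq ht.1) (hspeed _ (by simpa using ht.2))
  refine ⟨γ ∘ θ, θ ⁻¹' F ∩ ⋂ n, θ ⁻¹' G n, θ ⁻¹' F, ⟨hlip.lipschitzOnWith, c, hc, ?_⟩,
    fun t ht => hcube (hball t ht), inter_subset_left, hFI.trans Ioo_subset_Icc_self,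
    hFne.preimage θ.surjective, hFcl.preimage θ.continuous, hFpos.preimage θ hθL,
    isResidualIn_inter_iInter (fun n => (hG n).preimage θ.continuous)
      fun n => (hGF n).preimage θ, fun t ht => ?_, fun t ht => ?_, ?_⟩
  · rw [← Measure.restrict_congr_set Ioo_ae_eq_Icc, ae_restrict_iff' measurableSet_Ioo]
    filter_upwards [hlip.ae_differentiableAt_real] with t ht htI
    rw [derivWithin_Icc_eq_deriv htI]
    exact le_norm_deriv_of_antilipschitz hlow ht
  · obtain ⟨u, hu, hd⟩ := (hE t ht).exists_hasDerivAt
    rw [derivWithin_Icc_eq_deriv (hFI ht.1), hd.deriv]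
    exact ⟨hd.differentiableAt.differentiableWithinAt, hu⟩
  · exact (hE t ht).tendsto_essOsc hlip (hFI ht.1)
  · rintro _ ⟨t, ht, rfl⟩
    have := hγO (θ t) (by simpa using ht.2)
    exact (hO𝓐 ⟨this.1, this.2⟩).1
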